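/- Let $f:\mathbb{R}^N\to\mathbb{R}^N$ be continuously differentiable and invertible, with \[ L:=\inf_{x\in\mathbb{R}^N}\log_2|\det J(f)(x)|>-\infty ,\qquad M:=\sup_{x\in\mathbb{R}^N}\log_2|\det J(f)(x)|<\infty , \] where $J(f)(x)$ is the Jacobian matrix of $f$ at $x$. Let $B$ be a real $N\times m$ matrix. Consider the system \[ x_{t+1}=f(x_t)+Bu_t+w_t,\qquad t\ge 0, \] where $\{w_t\}$ is an i.i.d. $\mathbb{R}^N$-valued noise process, independent of $x_0$, and $x_0$ has a Lebesgue density $p$ whose differential entropy $h(x_0)=-\int p\log_2 p$ is defined in the extended reals and satisfies $h(x_0)<\infty$. The system is controlled over a channel with finite input alphabet $\mathcal M$ and finite output alphabet $\mathcal M'$, given by conditional laws $P(q'_t\mid q_{[0,t]},q'_{[0,t-1]})$, where $z_{[0,t]}=(z_0,\dots,z_t)$. A causal encoding and control policy consists of measurable functions $\gamma^e_t,\gamma_t$, $t\ge0$, with \[ q_t=\gamma^e_t(x_{[0,t]},q'_{[0,t-1]})\in\mathcal M,\qquad u_t=\gamma_t(q'_{[0,t]})\in\mathbb{R}^m . \]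 The channel with feedback is of Class A: for all $t\ge 0$ and all $D\subseteq\mathcal M'$, almost surely \[ P(q'_t\in D\mid q_{[0,t]},q'_{[0,t-1]},x_0,(w_s)_{s\ge0})=P(q'_t\in D\mid q_{[0,t]},q'_{[0,t-1]}), \] and its capacity $C$ is given by the following limit, which is assumed to exist: \[ C=\lim_{T\to\infty}\ \max_{\{P(q_t\mid q_{[0,t-1]},q'_{[0,t-1]}),\,0\le t\le T-1\}}\ \frac1T\, I(q_{[0,T-1]}\to q'_{[0,T-1]}), \] \[ I(q_{[0,T-1]}\to q'_{[0,T-1]})=I(q_0;q'_0)+\sum_{t=1}^{T-1}I(q_{[0,t]};q'_t\mid q'_{[0,t-1]}), \] with mutual information measured in bits. Suppose that under some causal encoding and control policy the state process $\{x_t\}_{t\ge0}$ is asymptotically mean stationary (AMS), that is, there is a probability measure $\bar P$ on $(\mathbb{R}^N)^{\mathbb{Z}_+}$ such that for every measurable $F\subseteq(\mathbb{R}^N)^{\mathbb{Z}_+}$ \[ \lim_{n\to\infty}\frac1n\sum_{k=0}^{n-1}P(\theta^{-k}F)=\bar P(F), \] where $P$ is the law of $(x_0,x_1,\dots)$ and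 $\theta(x_0,x_1,\dots)=(x_1,x_2,\dots)$ is the shift. Then $C\ge L$. -/

import Mathlib

open MeasureTheory ProbabilityTheory Filter Topology

noncomputable section

namespace NetworkedControl

/-! ### Information measures of finite-valued random variables (base 2) -/

section Information

variable {S α β γ : Type*} [Fintype α] [Fintype β] [Fintype γ]

/-- Conditional entropy `H(X | Y) = -∑ₓ,ᵧ p(x, y) log₂ p(x | y)`, in bits, of finite-valued
random variables `X`, `Y` on a discrete probability space `(S, p)`; terms with `p(x, y) = 0`
vanish. -/
def condEntropy (p : PMF S) (X : S → α) (Y : S → β) : ℝ :=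
  -∑ x, ∑ y, (p.map (fun s => (X s, Y s)) (x, y)).toReal *
    Real.logb 2 ((p.map (fun s => (X s, Y s)) (x, y)).toReal / (p.map Y y).toReal)

/-- Conditional mutual information `I(X; Y | Z) = H(X | Z) - H(X | Y, Z)`. -/
def condMutualInfo (p : PMF S) (X : S → α) (Y : S → β) (Z : S → γ) : ℝ :=
  condEntropy p X Z - condEntropy p X (fun s => (Y s, Z s))

end Information

/-! ### Channels with memory, feedback input policies, directed information, capacity -/

/-- A channel with input alphabet `A` and output alphabet `A'`: `W t a b` is the conditional law
of the output `q'_t` given `q_{[0,t]} = a` and `q'_{[0,t-1]} = b`. -/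
abbrev Channel (A A' : Type*) := (t : ℕ) → (Fin (t + 1) → A) → (Fin t → A') → PMF A'

/-- A causal input policy with feedback: `Q t a b` is the conditional law `P(q_t | q_{[0,t-1]} = a,
q'_{[0,t-1]} = b)` of the input. -/
abbrev InputPolicy (A A' : Type*) := (t : ℕ) → (Fin t → A) → (Fin t → A') → PMF A

section Capacity

variable {A A' : Type*}

/-- The joint law of the first `T` channel inputs and outputs `(q_{[0,T-1]}, q'_{[0,T-1]})`
when the channel `W` is used with the input policy `Q`. -/
def jointLaw (W : Channel A A') (Q : InputPolicy A A') :
    (T : ℕ) → PMF ((Fin T → A) × (Fin T → A'))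
  | 0 => PMF.pure (Fin.elim0, Fin.elim0)
  | T + 1 => (jointLaw W Q T).bind fun h => (Q T h.1 h.2).bind fun a =>
      (W T (Fin.snoc h.1 a) h.2).bind fun b => PMF.pure (Fin.snoc h.1 a, Fin.snoc h.2 b)

variable [Fintype A] [Fintype A']

/-- Directed information `I(q_{[0,T-1]} → q'_{[0,T-1]}) = ∑_{t<T} I(q'_t; q_{[0,t]} | q'_{[0,t-1]})`.
The term `t` depends only on the law of the first `t + 1` inputs and outputs. For `t = 0` the
conditioning variable is constant, so that this term is `I(q'_0; q_0)`. -/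
def directedInfo (W : Channel A A') (Q : InputPolicy A A') (T : ℕ) : ℝ :=
  ∑ t ∈ Finset.range T, condMutualInfo (jointLaw W Q (t + 1))
    (fun h => h.2 (Fin.last t)) (fun h => h.1) (fun h => Fin.init h.2)

/-- `C` is the feedback capacity given by the directed-information formula: the limit, as
`T → ∞`, of the maximum over causal input policies of `I(q_{[0,T-1]} → q'_{[0,T-1]}) / T`.
(The supremum is over a nonempty family bounded by `log₂ |A'|`.) -/
def IsFeedbackCapacity (W : Channel A A') (C : ℝ) : Prop :=
  Tendsto (fun T : ℕ => ⨆ Q : InputPolicy A A', directedInfo W Q T / (T : ℝ)) atTop (𝓝 C)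

end Capacity

/-! ### Differential entropy -/

section DifferentialEntropy

variable {E : Type*} [MeasureSpace E]

/-- The integral of the positive part of `-p log₂ p`, where `p` is the density of `μ`. -/
def entropyPosPart (μ : Measure E) : ENNReal :=
  ∫⁻ x, ENNReal.ofReal
    (-((μ.rnDeriv volume x).toReal * Real.logb 2 (μ.rnDeriv volume x).toReal))

/-- The integral of the negative part of `-p log₂ p`, where `p` is the density of `μ`. -/
def entropyNegPart (μ : Measure E) : ENNReal :=
  ∫⁻ x, ENNReal.ofReal
    ((μ.rnDeriv volume x).toReal * Real.logb 2 (μ.rnDeriv volume x).toReal)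

/-- The differential entropy of `μ` is defined: `μ` has a Lebesgue density `p`, and the integral
of `-p log₂ p` makes sense in the extended reals. -/
def HasDiffEntropy (μ : Measure E) : Prop :=
  μ ≪ volume ∧ (entropyPosPart μ ≠ ⊤ ∨ entropyNegPart μ ≠ ⊤)

/-- The differential entropy `h = -∫ p log₂ p`, an extended real. -/
def diffEntropy (μ : Measure E) : EReal :=
  (entropyPosPart μ : EReal) - (entropyNegPart μ : EReal)

end DifferentialEntropy

/-! ### Asymptotic mean stationarity -/

/-- The shift `(z₀, z₁, z₂, …) ↦ (z₁, z₂, z₃, …)` on one-sided sequences. -/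
def shift {E : Type*} (z : ℕ → E) : ℕ → E := fun n => z (n + 1)

/-- A process measure `P` on the sequence space is asymptotically mean stationary. -/
def IsAMS {E : Type*} [MeasurableSpace E] (P : Measure (ℕ → E)) : Prop :=
  ∃ Pbar : Measure (ℕ → E), IsProbabilityMeasure Pbar ∧
    ∀ F : Set (ℕ → E), MeasurableSet F →
      Tendsto (fun n : ℕ => (1 / (n : ℝ)) * ∑ k ∈ Finset.range n, P.real (shift^[k] ⁻¹' F))
        atTop (𝓝 (Pbar.real F))

/-! ### The system -/

/-- `log₂ |det J(f)(x)|`. -/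
def logJac {N : ℕ} (f : EuclideanSpace ℝ (Fin N) → EuclideanSpace ℝ (Fin N))
    (x : EuclideanSpace ℝ (Fin N)) : ℝ :=
  Real.logb 2 |(fderiv ℝ f x).det|

/-- `sup_x log₂ |det J(f)(x)| < ∞` and `inf_x log₂ |det J(f)(x)| > -∞`. As `log₂ 0 = -∞` on paper,
the second condition contains that the determinant never vanishes. -/
structure BoundedLogJac {N : ℕ}
    (f : EuclideanSpace ℝ (Fin N) → EuclideanSpace ℝ (Fin N)) : Prop where
  det_ne_zero : ∀ x, (fderiv ℝ f x).det ≠ 0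
  bddAbove : BddAbove (Set.range (logJac f))
  bddBelow : BddBelow (Set.range (logJac f))

section ClosedLoop

variable {Ω : Type*} [MeasurableSpace Ω] {A A' : Type*} [MeasurableSpace A] [MeasurableSpace A']

/-- The channel data `(q_{[0,t]}, q'_{[0,t-1]})`. -/
def channelPast (q : ℕ → Ω → A) (q' : ℕ → Ω → A') (t : ℕ) (ω : Ω) :
    (Fin (t + 1) → A) × (Fin t → A') :=
  (fun i => q i ω, fun i => q' i ω)

/-- The channel outputs `q'` are generated from the inputs `q` by the channel `W`: almost surely
`P(q'_t = b | q_{[0,t]}, q'_{[0,t-1]}) = W_t(b | q_{[0,t]}, q'_{[0,t-1]})`. -/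
def GeneratedByChannel (μ : Measure Ω) (W : Channel A A')
    (q : ℕ → Ω → A) (q' : ℕ → Ω → A') : Prop :=
  ∀ (t : ℕ) (b : A'),
    μ⟦q' t ⁻¹' {b} | MeasurableSpace.comap (channelPast q q' t) inferInstance⟧ =ᵐ[μ]
      fun ω => (W t (channelPast q q' t ω).1 (channelPast q q' t ω).2 b).toReal

/-- The Markov chain condition `q'_t ↔ (q_{[0,t]}, q'_{[0,t-1]}) ↔ (x₀, (w_s)_{s ≥ 0})`. -/
def ChannelMarkov {E : Type*} [MeasurableSpace E] (μ : Measure Ω)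
    (x₀ : Ω → E) (w : ℕ → Ω → E) (q : ℕ → Ω → A) (q' : ℕ → Ω → A') : Prop :=
  ∀ (t : ℕ) (S : Set A'), MeasurableSet S →
    μ⟦q' t ⁻¹' S | MeasurableSpace.comap
        (fun ω => (channelPast q q' t ω, x₀ ω, fun s => w s ω)) inferInstance⟧ =ᵐ[μ]
      μ⟦q' t ⁻¹' S | MeasurableSpace.comap (channelPast q q' t) inferInstance⟧

/-- Class A channel with feedback, of capacity `C`: the Markov chain condition holds, and the
capacity is given by the directed-information formula. -/
structure IsClassA [Fintype A] [Fintype A'] {E : Type*} [MeasurableSpace E] (μ : Measure Ω)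
    (W : Channel A A') (C : ℝ) (x₀ : Ω → E) (w : ℕ → Ω → E)
    (q : ℕ → Ω → A) (q' : ℕ → Ω → A') : Prop where
  markov : ChannelMarkov μ x₀ w q q'
  capacity : IsFeedbackCapacity W C

/-- The noise `w` is i.i.d. with law `ν`, and independent of the initial state `x₀`. -/
structure IsNoise {E : Type*} [MeasurableSpace E] (μ : Measure Ω) (ν : Measure E)
    (x₀ : Ω → E) (w : ℕ → Ω → E) : Prop where
  measurable_init : Measurable x₀
  measurable_noise : ∀ t, Measurable (w t)
  law : ∀ t, μ.map (w t) = ν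
  iIndep : iIndepFun w μ
  indep_init : IndepFun x₀ (fun ω t => w t ω) μ

/-- The closed loop `x_{t+1} = f(x_t) + B u_t + w_t` under the causal coding policy
`q_t = γᵉ_t(x_{[0,t]}, q'_{[0,t-1]})` and the causal control policy `u_t = γ_t(q'_{[0,t]})`,
the channel outputs `q'` being generated from `q` by `W`. -/
structure IsClosedLoop {N m : ℕ} (μ : Measure Ω)
    (f : EuclideanSpace ℝ (Fin N) → EuclideanSpace ℝ (Fin N)) (B : Matrix (Fin N) (Fin m) ℝ)
    (W : Channel A A')
    (γe : (t : ℕ) → (Fin (t + 1) → EuclideanSpace ℝ (Fin N)) → (Fin t → A') → A)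
    (γ : (t : ℕ) → (Fin (t + 1) → A') → EuclideanSpace ℝ (Fin m))
    (x w : ℕ → Ω → EuclideanSpace ℝ (Fin N)) (u : ℕ → Ω → EuclideanSpace ℝ (Fin m))
    (q : ℕ → Ω → A) (q' : ℕ → Ω → A') : Prop where
  measurable_encoder : ∀ t, Measurable (Function.uncurry (γe t))
  measurable_controller : ∀ t, Measurable (γ t)
  measurable_output : ∀ t, Measurable (q' t)
  encoder : ∀ t ω, q t ω = γe t (fun i => x i ω) (fun i => q' i ω)
  controller : ∀ t ω, u t ω = γ t (fun i => q' i ω)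
  channel : GeneratedByChannel μ W q q'
  dynamics : ∀ t ω, x (t + 1) ω = f (x t ω) + Matrix.toEuclideanLin B (u t ω) + w t ω

end ClosedLoop

end NetworkedControl

end

/-! The converse is a change-of-measure argument on one event: the initial state lies in a set `G`
where its density is bounded by some `M`, and `x_T` lies in a fixed ball `K`.

Freeze the channel outputs to a sequence `b`. The controls are then constants, the disturbance
depends on the noise alone and is independent of `x_0`, and every step of the plant expands volume
by at least `2 ^ L`. So the event has probability at most `M * 2 ^ (-L T) * vol K`, uniformly in `b`
(`measure_orbit_mem_le`). In closed loop its probability is nevertheless close to one for infinitely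
many `T`: `G` is chosen nearly full, and asymptotic mean stationarity makes the state return to a
suitable ball (`IsAMS.exists_closedBall`).

Information through the channel has to pay for this discrepancy. By the Class A property, dividing
by the likelihood of the outputs given the inputs decouples the outputs from `(x_0, w)`
(`lintegral_div_outputLikelihood_le`). With the information density `i = log₂ (likelihood /
P(outputs))` and frozen probabilities at most `exp (-c)`, this gives `E[(1 + exp c * 1_s) * 2 ^
(-i)] ≤ 2`, and `y + 1 ≤ exp y` turns it into `c * P(s) - 1 ≤ log 2 * E[i]`
(`mul_measure_sub_one_le_integral_infoDensity`).

Finally `E[i]` is exactly the directed information for the input policy that the closed loop induces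
(`directedInfo_eq_integral`), hence at most the supremum defining capacity. Since `c` is `T * L *
log 2` up to a constant, dividing by `T` and letting the losses vanish gives the bound. -/

namespace NetworkedControl

/-! ### Volume expansion of the plant and hitting probabilities under frozen controls. -/

section Plant

/-- A differentiable injection that expands volume by at least `δ` everywhere contracts the volume
of preimages by `δ`. -/
theorem volume_preimage_le {N : ℕ} {f : EuclideanSpace ℝ (Fin N) → EuclideanSpace ℝ (Fin N)}
    (hf : Differentiable ℝ f) (hinj : Function.Injective f) {δ : ℝ} (hδ : 0 < δ)
    (hdet : ∀ x, δ ≤ |(fderiv ℝ f x).det|) {S : Set (EuclideanSpace ℝ (Fin N))}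
    (hS : MeasurableSet S) :
    volume (f ⁻¹' S) ≤ ENNReal.ofReal δ⁻¹ * volume S := by
  have hm : MeasurableSet (f ⁻¹' S) := hf.continuous.measurable hS
  have h := lintegral_abs_det_fderiv_eq_addHaar_image volume hm
    (fun x _ => (hf x).hasFDerivAt.hasFDerivWithinAt) hinj.injOn
  have h1 : ENNReal.ofReal δ * volume (f ⁻¹' S) ≤ volume S := by
    calc ENNReal.ofReal δ * volume (f ⁻¹' S) = ∫⁻ _ in f ⁻¹' S, ENNReal.ofReal δ := by simp
      _ ≤ ∫⁻ x in f ⁻¹' S, ENNReal.ofReal |(fderiv ℝ f x).det| :=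
        lintegral_mono fun x => ENNReal.ofReal_le_ofReal (hdet x)
      _ = volume (f '' (f ⁻¹' S)) := h
      _ ≤ volume S := measure_mono (Set.image_preimage_subset f S)
  calc volume (f ⁻¹' S)
      = ENNReal.ofReal δ⁻¹ * (ENNReal.ofReal δ * volume (f ⁻¹' S)) := by
        rw [← mul_assoc, ← ENNReal.ofReal_mul (inv_nonneg.2 hδ.le), inv_mul_cancel₀ hδ.ne']
        simp
    _ ≤ _ := by gcongr

/-- The state at time `t` of the recursion `x_{t+1} = f(x_t) + v_t` started at `x`. -/
def orbit {E : Type*} [Add E] (f : E → E) (v : ℕ → E) : ℕ → E → E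
  | 0, x => x
  | t + 1, x => f (orbit f v t x) + v t

theorem orbit_congr {E : Type*} [Add E] (f : E → E) {v v' : ℕ → E} {T : ℕ}
    (h : ∀ t < T, v t = v' t) (x : E) : orbit f v T x = orbit f v' T x := by
  induction T with
  | zero => rfl
  | succ t ih => rw [orbit, orbit, ih fun s hs => h s (by omega), h t (by omega)]

theorem eq_orbit {E : Type*} [Add E] {f : E → E} {v x : ℕ → E}
    (h : ∀ t, x (t + 1) = f (x t) + v t) (t : ℕ) : x t = orbit f v t (x 0) := by
  induction t with
  | zero => rfl
  | succ t ih => rw [h, ih, orbit]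

theorem measurable_orbit {E X : Type*} [Add E] [MeasurableSpace E] [MeasurableAdd₂ E]
    [MeasurableSpace X] {f : E → E} (hf : Measurable f) {v : X → ℕ → E} {x : X → E}
    (hv : ∀ t, Measurable fun ω => v ω t) (hx : Measurable x) (t : ℕ) :
    Measurable fun ω => orbit f (v ω) t (x ω) := by
  induction t with
  | zero => exact hx
  | succ t ih => exact (hf.comp ih).add (hv t)

/-- For a fixed disturbance sequence each step is `f` followed by a translation. Translations
preserve volume, so only `f` contributes a factor. The set varies in the induction because the last
step is peeled off first. -/
theorem volume_orbit_preimage_le {N : ℕ}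
    {f : EuclideanSpace ℝ (Fin N) → EuclideanSpace ℝ (Fin N)}
    (hf : Differentiable ℝ f) (hinj : Function.Injective f) {δ : ℝ} (hδ : 0 < δ)
    (hdet : ∀ x, δ ≤ |(fderiv ℝ f x).det|) (v : ℕ → EuclideanSpace ℝ (Fin N)) (T : ℕ)
    {S : Set (EuclideanSpace ℝ (Fin N))} (hS : MeasurableSet S) :
    volume (orbit f v T ⁻¹' S) ≤ ENNReal.ofReal δ⁻¹ ^ T * volume S := by
  induction T generalizing S with
  | zero => simp [orbit]
  | succ t ih =>
    have hS' : MeasurableSet ((fun y => y + v t) ⁻¹' S) := measurable_add_const _ hS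
    calc volume (orbit f v t ⁻¹' (f ⁻¹' ((fun y => y + v t) ⁻¹' S)))
        ≤ ENNReal.ofReal δ⁻¹ ^ t * volume (f ⁻¹' ((fun y => y + v t) ⁻¹' S)) :=
          ih (hf.continuous.measurable hS')
      _ ≤ ENNReal.ofReal δ⁻¹ ^ t *
          (ENNReal.ofReal δ⁻¹ * volume ((fun y => y + v t) ⁻¹' S)) := by
          gcongr
          exact volume_preimage_le hf hinj hδ hdet hS'
      _ = _ := by rw [measure_preimage_add_right, pow_succ, mul_assoc]

/-- An absolutely continuous probability measure has bounded density on a set of nearly full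
measure. -/
theorem exists_bounded_density_set {E : Type*} [MeasurableSpace E] {P vol : Measure E}
    [IsProbabilityMeasure P] [SigmaFinite vol] (hP : P ≪ vol) {ε : ℝ} (hε : 0 < ε) :
    ∃ G, MeasurableSet G ∧ P.real Gᶜ ≤ ε ∧
      ∃ M : ℕ, ∀ S, MeasurableSet S → P (G ∩ S) ≤ M * vol S := by
  set g := P.rnDeriv vol
  have hg : Measurable g := Measure.measurable_rnDeriv _ _
  have hPg : vol.withDensity g = P := Measure.withDensity_rnDeriv_eq _ _ hP
  -- The superlevel sets of the density decrease to the set where it is infinite, which is null; `G`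
  -- is the complement of one that is small enough.
  have hanti : Antitone fun n : ℕ => {x | (n : ENNReal) < g x} := fun a b hab x hx => by
    exact lt_of_le_of_lt (Nat.cast_le.2 hab : (a : ENNReal) ≤ b) hx
  have hlim := tendsto_measure_iInter_atTop (μ := P)
    (s := fun n : ℕ => {x | (n : ENNReal) < g x})
    (fun n => (measurableSet_lt measurable_const hg).nullMeasurableSet) hanti
    ⟨0, measure_ne_top _ _⟩
  have hzero : P (⋂ n : ℕ, {x | (n : ENNReal) < g x}) = 0 := by
    have hlt : ∀ᵐ x ∂P, g x < ⊤ := hP.ae_le (Measure.rnDeriv_lt_top P vol)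
    refine measure_mono_null (fun x hx => ?_) (ae_iff.1 hlt)
    simp only [Set.mem_iInter, Set.mem_ofPred_eq] at hx ⊢
    intro h
    obtain ⟨n, hn⟩ := ENNReal.exists_nat_gt h.ne
    exact (hx n).not_gt hn
  rw [hzero] at hlim
  obtain ⟨M, hM⟩ := (hlim.eventually (gt_mem_nhds (ENNReal.ofReal_pos.2 hε))).exists
  refine ⟨{x | g x ≤ M}, measurableSet_le hg measurable_const, ?_, M, fun S hS => ?_⟩
  · have : {x | g x ≤ M}ᶜ = {x | (M : ENNReal) < g x} := by ext; simp
    rw [this, measureReal_def]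
    exact ENNReal.toReal_le_of_le_ofReal hε.le hM.le
  · have hG : MeasurableSet {x | g x ≤ M} := measurableSet_le hg measurable_const
    calc P ({x | g x ≤ M} ∩ S) = ∫⁻ x in {x | g x ≤ M} ∩ S, g x ∂vol := by
          conv_lhs => rw [← hPg]
          rw [withDensity_apply _ (hG.inter hS)]
      _ ≤ ∫⁻ _ in {x | g x ≤ M} ∩ S, M ∂vol :=
          setLIntegral_mono measurable_const fun x hx => hx.1
      _ = M * vol ({x | g x ≤ M} ∩ S) := by simp
      _ ≤ M * vol S := by gcongr; exact Set.inter_subset_right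

/-- If the disturbance `v` is a function of a variable `y` independent of the initial state, the
state reaches `K` from a set where the density of the initial state is at most `M` with
probability at most `M δ⁻ᵀ vol(K)`. -/
theorem measure_orbit_mem_le {Ω Y : Type*} [MeasurableSpace Ω] [MeasurableSpace Y]
    {μ : Measure Ω} [IsProbabilityMeasure μ] {N : ℕ}
    {f : EuclideanSpace ℝ (Fin N) → EuclideanSpace ℝ (Fin N)}
    (hf : Differentiable ℝ f) (hinj : Function.Injective f) {δ : ℝ} (hδ : 0 < δ)
    (hdet : ∀ x, δ ≤ |(fderiv ℝ f x).det|)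
    {x₀ : Ω → EuclideanSpace ℝ (Fin N)} {y : Ω → Y} (hx₀ : Measurable x₀) (hy : Measurable y)
    (hind : IndepFun x₀ y μ) {v : Y → ℕ → EuclideanSpace ℝ (Fin N)}
    (hv : ∀ t, Measurable fun η => v η t) {G K : Set (EuclideanSpace ℝ (Fin N))}
    (hG : MeasurableSet G) (hK : MeasurableSet K) {M : ENNReal}
    (hM : ∀ S, MeasurableSet S → μ.map x₀ (G ∩ S) ≤ M * volume S) (T : ℕ) :
    μ {ω | x₀ ω ∈ G ∧ orbit f (v (y ω)) T (x₀ ω) ∈ K} ≤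
      M * (ENNReal.ofReal δ⁻¹ ^ T * volume K) := by
  have : IsProbabilityMeasure (μ.map x₀) := Measure.isProbabilityMeasure_map hx₀.aemeasurable
  have : IsProbabilityMeasure (μ.map y) := Measure.isProbabilityMeasure_map hy.aemeasurable
  have hprod := (indepFun_iff_map_prod_eq_prod_map_map hx₀.aemeasurable hy.aemeasurable).1 hind
  have horb : Measurable fun p : EuclideanSpace ℝ (Fin N) × Y => orbit f (v p.2) T p.1 :=
    measurable_orbit hf.continuous.measurable (fun t => (hv t).comp measurable_snd)
      measurable_fst T
  have hE : MeasurableSet {p : EuclideanSpace ℝ (Fin N) × Y |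
      p.1 ∈ G ∧ orbit f (v p.2) T p.1 ∈ K} := (measurable_fst hG).inter (horb hK)
  calc μ {ω | x₀ ω ∈ G ∧ orbit f (v (y ω)) T (x₀ ω) ∈ K}
      = μ.map (fun ω => (x₀ ω, y ω)) {p | p.1 ∈ G ∧ orbit f (v p.2) T p.1 ∈ K} := by
        rw [Measure.map_apply (hx₀.prodMk hy) hE]; rfl
    -- Independence gives a product law, so Fubini reduces the bound to a fixed disturbance
    -- sequence.
    _ = ∫⁻ η, μ.map x₀ (G ∩ orbit f (v η) T ⁻¹' K) ∂μ.map y := by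
        rw [hprod, Measure.prod_apply_symm hE]; rfl
    _ ≤ ∫⁻ _, M * (ENNReal.ofReal δ⁻¹ ^ T * volume K) ∂μ.map y := by
        refine lintegral_mono fun η => (hM _ ?_).trans ?_
        · exact measurable_orbit (X := EuclideanSpace ℝ (Fin N)) (v := fun _ => v η)
            hf.continuous.measurable (fun t => measurable_const) measurable_id T hK
        · gcongr
          exact volume_orbit_preimage_le hf hinj hδ hdet _ T hK
    _ = _ := by simp

end Plant

/-! ### Recurrence of an AMS process to a ball. -/

section Stationarity

/-- Some compact ball is visited with probability close to one at infinitely many times. -/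
theorem IsAMS.exists_closedBall {Ω : Type*} [MeasurableSpace Ω] {μ : Measure Ω}
    [IsProbabilityMeasure μ] {E : Type*} [NormedAddCommGroup E] [MeasurableSpace E]
    [BorelSpace E] {x : ℕ → Ω → E} (hx : ∀ t, Measurable (x t))
    (h : IsAMS (μ.map fun ω t => x t ω)) {ε : ℝ} (hε : 0 < ε) :
    ∃ r : ℝ, ∃ᶠ T in atTop, 1 - ε ≤ μ.real (x T ⁻¹' Metric.closedBall 0 r) := by
  obtain ⟨P, hP, h⟩ := h
  have hxm : Measurable fun ω t => x t ω := measurable_pi_lambda _ hx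
  have hmono : Monotone fun n : ℕ => {z : ℕ → E | z 0 ∈ Metric.closedBall 0 (n : ℝ)} :=
    fun a b hab z hz => Metric.closedBall_subset_closedBall (by exact_mod_cast hab) hz
  have hlim := tendsto_measure_iUnion_atTop (μ := P) hmono
  have huniv : (⋃ n : ℕ, {z : ℕ → E | z 0 ∈ Metric.closedBall 0 (n : ℝ)}) = Set.univ := by
    refine Set.eq_univ_of_forall fun z => Set.mem_iUnion.2 ?_
    obtain ⟨n, hn⟩ := exists_nat_ge ‖z 0‖
    exact ⟨n, by simpa using hn⟩
  rw [huniv, measure_univ] at hlim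
  have hlim' : Tendsto (fun n : ℕ => P.real {z : ℕ → E | z 0 ∈ Metric.closedBall 0 (n : ℝ)})
      atTop (𝓝 1) := (ENNReal.tendsto_toReal ENNReal.one_ne_top).comp hlim
  -- The radius is chosen for the stationary mean `P`, with strict inequality; the Cesàro limit must
  -- later contradict it.
  obtain ⟨n, hn⟩ := (hlim'.eventually (lt_mem_nhds (by linarith : 1 - ε < 1))).exists
  refine ⟨n, ?_⟩
  have hF : MeasurableSet {z : ℕ → E | z 0 ∈ Metric.closedBall 0 (n : ℝ)} :=
    measurable_pi_apply 0 Metric.isClosed_closedBall.measurableSet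
  have hshift : ∀ k (z : ℕ → E) i, (shift^[k] z) i = z (i + k) := by
    intro k
    induction k with
    | zero => intro z i; rfl
    | succ k ih => intro z i; rw [Function.iterate_succ_apply, ih]; simp [shift, add_assoc]
  have hP' : ∀ k, (μ.map fun ω t => x t ω).real
      (shift^[k] ⁻¹' {z : ℕ → E | z 0 ∈ Metric.closedBall 0 (n : ℝ)}) =
      μ.real (x k ⁻¹' Metric.closedBall 0 n) := by
    intro k
    have : shift^[k] ⁻¹' {z : ℕ → E | z 0 ∈ Metric.closedBall 0 (n : ℝ)} =
        (fun z => z k) ⁻¹' Metric.closedBall 0 (n : ℝ) := by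
      ext z; simp [hshift]
    rw [this, map_measureReal_apply hxm
      (measurable_pi_apply k Metric.isClosed_closedBall.measurableSet)]
    rfl
  have hces := h _ hF
  simp only [hP'] at hces
  by_contra hcon
  rw [not_frequently, eventually_atTop] at hcon
  obtain ⟨n₀, hn₀⟩ := hcon
  set a := fun k => μ.real (x k ⁻¹' Metric.closedBall 0 (n : ℝ))
  have ha : ∀ k, a k ≤ 1 := fun k => measureReal_le_one
  -- If visits had probability below `1 - ε` from time `n₀` on, only the first `n₀` terms could
  -- exceed that level, each by at most `ε`. The excess vanishes in the average, so the limit would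
  -- be at most `1 - ε`.
  have hbound : ∀ᶠ k : ℕ in atTop,
      1 / (k : ℝ) * ∑ i ∈ Finset.range k, a i ≤ (1 - ε) + ε * n₀ * (1 / (k : ℝ)) := by
    filter_upwards [eventually_ge_atTop (n₀ + 1)] with k hk
    have hsum : ∑ i ∈ Finset.range k, a i ≤ k * (1 - ε) + ε * n₀ := by
      have : ∀ k, n₀ ≤ k → ∑ i ∈ Finset.range k, a i ≤ k * (1 - ε) + ε * n₀ := by
        intro k hk
        induction k, hk using Nat.le_induction with
        | base =>
          have : ∑ i ∈ Finset.range n₀, a i ≤ ∑ i ∈ Finset.range n₀, (1 : ℝ) :=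
            Finset.sum_le_sum fun i _ => ha i
          simp only [Finset.sum_const, Finset.card_range, nsmul_eq_mul] at this
          linarith
        | succ k hk ih =>
          rw [Finset.sum_range_succ]
          have := not_le.1 (hn₀ k hk)
          push_cast
          linarith
      exact this k (by omega)
    have hk0 : (0 : ℝ) < k := by exact_mod_cast (by omega : 0 < k)
    calc 1 / (k : ℝ) * ∑ i ∈ Finset.range k, a i ≤ 1 / (k : ℝ) * (k * (1 - ε) + ε * n₀) := by
          gcongr
      _ = _ := by field_simp
  have hle := le_of_tendsto_of_tendsto hces
    ((tendsto_const_nhds (x := 1 - ε)).add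
      (tendsto_one_div_atTop_nhds_zero_nat.const_mul (ε * (n₀ : ℝ)))) hbound
  simp only [mul_zero, add_zero] at hle
  linarith

end Stationarity

/-! ### The conditional law of the outputs and the decoupling by likelihoods. -/

section ChannelLaw

/-- If `κ` is a version of the conditional probability of `s` given `m`, then it integrates
`m`-measurable functions over `s`. -/
theorem setLIntegral_eq_lintegral_mul_of_forall {Ω : Type*} {m m₀ : MeasurableSpace Ω}
    (hm : m ≤ m₀) {μ : Measure Ω} [IsFiniteMeasure μ] {s : Set Ω} {κ : Ω → ENNReal}
    (hκ : Measurable[m] κ)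
    (h : ∀ S, MeasurableSet[m] S → μ (S ∩ s) = ∫⁻ ω in S, κ ω ∂μ) {g : Ω → ENNReal}
    (hg : Measurable[m] g) : ∫⁻ ω in s, g ω ∂μ = ∫⁻ ω, κ ω * g ω ∂μ := by
  have hmeas : (μ.restrict s).trim hm = (μ.trim hm).withDensity κ := by
    refine @Measure.ext _ m _ _ fun S hS => ?_
    rw [trim_measurableSet_eq hm hS, Measure.restrict_apply (hm _ hS), h S hS,
      withDensity_apply _ hS, restrict_trim hm _ hS, lintegral_trim hm hκ]
  rw [← lintegral_trim hm hg, hmeas, lintegral_withDensity_eq_lintegral_mul _ hκ hg,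
    lintegral_trim hm (hκ.mul hg)]
  rfl

theorem measurable_channelPast {Ω A A' : Type*} [MeasurableSpace Ω] [MeasurableSpace A]
    [MeasurableSpace A'] {q : ℕ → Ω → A} {q' : ℕ → Ω → A'} {t : ℕ}
    (hq : ∀ i ≤ t, Measurable (q i)) (hq' : ∀ i < t, Measurable (q' i)) :
    Measurable (channelPast q q' t) :=
  (measurable_pi_lambda _ fun i : Fin (t + 1) => hq i (by omega)).prodMk
    (measurable_pi_lambda _ fun i : Fin t => hq' i i.2)

variable {Ω : Type*} [MeasurableSpace Ω] {A A' : Type*} [Fintype A] [MeasurableSpace A]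
  [DiscreteMeasurableSpace A] [Fintype A'] [MeasurableSpace A'] [DiscreteMeasurableSpace A']

/-- The information in the channel data before the output at time `t`, the initial state and the
noise. -/
abbrev jointPast {E : Type*} [MeasurableSpace E] (x₀ : Ω → E) (w : ℕ → Ω → E) (q : ℕ → Ω → A)
    (q' : ℕ → Ω → A') (t : ℕ) : MeasurableSpace Ω :=
  MeasurableSpace.comap (fun ω => (channelPast q q' t ω, x₀ ω, fun s => w s ω)) inferInstance

/-- For a Class A channel, the conditional law of the output given the channel past, the initial
state and the noise is that of the channel. -/
theorem measure_inter_output_eq {E : Type*} [MeasurableSpace E] {μ : Measure Ω}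
    [IsProbabilityMeasure μ] {W : Channel A A'} {x₀ : Ω → E} {w : ℕ → Ω → E} {q : ℕ → Ω → A}
    {q' : ℕ → Ω → A'} (hx₀ : Measurable x₀) (hw : ∀ t, Measurable (w t))
    (hq : ∀ t, Measurable (q t)) (hq' : ∀ t, Measurable (q' t))
    (hmarkov : ChannelMarkov μ x₀ w q q') (hgen : GeneratedByChannel μ W q q') (t : ℕ) (b : A')
    {S : Set Ω} (hS : MeasurableSet[jointPast x₀ w q q' t] S) :
    μ (S ∩ q' t ⁻¹' {b}) =
      ∫⁻ ω in S, W t (channelPast q q' t ω).1 (channelPast q q' t ω).2 b ∂μ := by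
  have hpast : Measurable (channelPast q q' t) :=
    measurable_channelPast (fun i _ => hq i) fun i _ => hq' i
  have hY : Measurable fun ω => (channelPast q q' t ω, x₀ ω, fun s => w s ω) :=
    hpast.prodMk (hx₀.prodMk (measurable_pi_lambda _ hw))
  have hm := hY.comap_le
  have hae := (hmarkov t {b} (measurableSet_singleton b)).trans (hgen t b)
  have hs : MeasurableSet (q' t ⁻¹' {b}) := hq' t (measurableSet_singleton b)
  have hint : Integrable ((q' t ⁻¹' {b}).indicator fun _ => (1 : ℝ)) μ :=
    (integrable_const 1).indicator hs
  have h1 := setIntegral_condExp hm hint hS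
  rw [setIntegral_congr_ae (g := fun ω =>
      (W t (channelPast q q' t ω).1 (channelPast q q' t ω).2 b).toReal) (hm _ hS)
      (hae.mono fun ω h _ => h), integral_indicator_const _ hs,
    integral_toReal] at h1
  · have hfin : ∫⁻ ω in S, W t (channelPast q q' t ω).1 (channelPast q q' t ω).2 b ∂μ ≠ ⊤ := by
      refine ne_top_of_le_ne_top (measure_ne_top μ S) ?_
      calc _ ≤ ∫⁻ _ in S, 1 ∂μ := lintegral_mono fun ω => PMF.coe_le_one _ _
        _ = μ S := by simp
    rw [← ENNReal.toReal_eq_toReal_iff' (measure_ne_top _ _) hfin, h1]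
    simp [measureReal_def, Measure.restrict_apply hs, Set.inter_comm]
  · exact ((Measurable.of_discrete (f := fun p : (Fin (t + 1) → A) × (Fin t → A') =>
      W t p.1 p.2 b)).comp hpast).aemeasurable
  · exact ae_of_all _ fun ω => lt_of_le_of_lt (PMF.coe_le_one _ _) ENNReal.one_lt_top

/-- The likelihood of the outputs `b_0, …, b_{T-1}` given the inputs. -/
noncomputable def outputLikelihood (W : Channel A A') (q : ℕ → Ω → A) (b : ℕ → A') (T : ℕ) (ω : Ω) : ENNReal :=
  ∏ t ∈ Finset.range T, W t (fun i => q i ω) (fun i => b i) (b t)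

/-- Dividing by the likelihood of the outputs decouples them from the initial state and the
noise. -/
theorem lintegral_div_outputLikelihood_le {E : Type*} [MeasurableSpace E] {μ : Measure Ω}
    [IsProbabilityMeasure μ] {W : Channel A A'} {x₀ : Ω → E} {w : ℕ → Ω → E} {q : ℕ → Ω → A}
    {q' : ℕ → Ω → A'} (hx₀ : Measurable x₀) (hw : ∀ t, Measurable (w t))
    (hq : ∀ t, Measurable (q t)) (hq' : ∀ t, Measurable (q' t))
    (hmarkov : ChannelMarkov μ x₀ w q q') (hgen : GeneratedByChannel μ W q q')
    {ψ : E × (ℕ → E) → ENNReal} (hψ : Measurable ψ) (b : ℕ → A') (T : ℕ) :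
    ∫⁻ ω in {ω | ∀ i < T, q' i ω = b i},
        ψ (x₀ ω, fun s => w s ω) * (outputLikelihood W q b T ω)⁻¹ ∂μ ≤
      ∫⁻ ω, ψ (x₀ ω, fun s => w s ω) ∂μ := by
  induction T with
  | zero => simp [outputLikelihood]
  | succ T ih =>
    -- The last output is integrated out: given the joint past, it contributes the factor `κ`, which
    -- cancels the new factor of the likelihood.
    refine le_trans ?_ ih
    set Y := fun ω => (channelPast q q' T ω, x₀ ω, fun s => w s ω) with hYdef
    have hpast : Measurable (channelPast q q' T) :=
      measurable_channelPast (fun i _ => hq i) fun i _ => hq' i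
    have hY : Measurable Y := hpast.prodMk (hx₀.prodMk (measurable_pi_lambda _ hw))
    have hm := hY.comap_le
    have hYm : Measurable[jointPast x₀ w q q' T] Y := comap_measurable Y
    have hpm : Measurable[jointPast x₀ w q q' T] (channelPast q q' T) := measurable_fst.comp hYm
    have hqm' : ∀ i < T, Measurable[jointPast x₀ w q q' T] (q' i) := fun i hi =>
      (measurable_pi_apply (⟨i, hi⟩ : Fin T)).comp (measurable_snd.comp hpm)
    have hfac : ∀ t ≤ T, Measurable[jointPast x₀ w q q' T] fun ω => W t (fun i => q i ω) (fun i => b i) (b t) := by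
      intro t ht
      exact (Measurable.of_discrete (f := fun p : (Fin (T + 1) → A) × (Fin T → A') =>
        W t (fun i => p.1 ⟨i, by omega⟩) (fun i => b i) (b t))).comp hpm
    have hlik : Measurable[jointPast x₀ w q q' T] (outputLikelihood W q b T) := by
      unfold outputLikelihood
      exact Finset.measurable_fun_prod _ fun t ht => hfac t (Finset.mem_range.1 ht).le
    have hset : MeasurableSet[jointPast x₀ w q q' T] {ω | ∀ i < T, q' i ω = b i} := by
      have : {ω | ∀ i < T, q' i ω = b i} = ⋂ i : Fin T, q' i ⁻¹' {b i} := by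
        ext ω
        simp only [Set.mem_ofPred_eq, Set.mem_iInter, Set.mem_preimage, Set.mem_singleton_iff]
        exact ⟨fun h i => h i i.2, fun h i hi => h ⟨i, hi⟩⟩
      rw [this]
      exact MeasurableSet.iInter fun i => hqm' i i.2 (measurableSet_singleton _)
    have hψm : Measurable[jointPast x₀ w q q' T] fun ω => ψ (x₀ ω, fun s => w s ω) :=
      hψ.comp (measurable_snd.comp hYm)
    set s := {ω | ∀ i < T, q' i ω = b i} with hs
    have hsplit : {ω | ∀ i < T + 1, q' i ω = b i} = s ∩ q' T ⁻¹' {b T} := by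
      ext ω
      simp only [hs, Set.mem_ofPred_eq, Set.mem_inter_iff, Set.mem_preimage,
        Set.mem_singleton_iff]
      exact ⟨fun h => ⟨fun i hi => h i (by omega), h T (by omega)⟩, fun h i hi =>
        (Nat.lt_succ_iff_lt_or_eq.1 hi).elim (h.1 i) fun e => e ▸ h.2⟩
    set κ := fun ω => W T (channelPast q q' T ω).1 (channelPast q q' T ω).2 (b T) with hκdef
    have hκ : Measurable[jointPast x₀ w q q' T] κ := (Measurable.of_discrete
      (f := fun p : (Fin (T + 1) → A) × (Fin T → A') => W T p.1 p.2 (b T))).comp hpm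
    have hint := fun (g : Ω → ENNReal) (hg : Measurable[jointPast x₀ w q q' T] g) =>
      setLIntegral_eq_lintegral_mul_of_forall hm (s := q' T ⁻¹' {b T}) (κ := κ) hκ
        (fun S hS => measure_inter_output_eq hx₀ hw hq hq' hmarkov hgen T (b T) hS) hg
    set g₀ := fun ω => ψ (x₀ ω, fun s => w s ω) * (outputLikelihood W q b T ω)⁻¹ with hg₀
    have hg₀m : Measurable[jointPast x₀ w q q' T] g₀ := hψm.mul hlik.inv
    -- Everything except the event `q'_T = b_T` is determined by the joint past, which already
    -- contains the input `q_T`.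
    have hgm : Measurable[jointPast x₀ w q q' T] (s.indicator fun ω => g₀ ω * (κ ω)⁻¹) :=
      (hg₀m.mul hκ.inv).indicator hset
    have hκs : ∀ ω ∈ s, κ ω = W T (fun i => q i ω) (fun i => b i) (b T) := by
      intro ω hω
      have : (fun i : Fin T => q' i ω) = fun i : Fin T => b i := funext fun i => hω i i.2
      simp only [hκdef, channelPast, this]
    have hlik1 : ∀ ω, (outputLikelihood W q b T ω) ≠ ⊤ := fun ω =>
      ENNReal.prod_ne_top fun t _ => PMF.apply_ne_top _ _
    calc ∫⁻ ω in {ω | ∀ i < T + 1, q' i ω = b i},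
          ψ (x₀ ω, fun s => w s ω) * (outputLikelihood W q b (T + 1) ω)⁻¹ ∂μ
        = ∫⁻ ω in q' T ⁻¹' {b T}, s.indicator (fun ω => g₀ ω * (κ ω)⁻¹) ω ∂μ := by
          rw [lintegral_indicator (hm _ hset), Measure.restrict_restrict (hm _ hset), hsplit]
          refine setLIntegral_congr_fun ((hm _ hset).inter (hq' T (measurableSet_singleton _)))
            fun ω hω => ?_
          simp only [hg₀]
          rw [hκs ω hω.1, outputLikelihood, Finset.prod_range_succ, ENNReal.mul_inv, mul_assoc]
          · rfl
          · exact Or.inr (PMF.apply_ne_top _ _)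
          · exact Or.inl (hlik1 ω)
      _ = ∫⁻ ω, κ ω * s.indicator (fun ω => g₀ ω * (κ ω)⁻¹) ω ∂μ := hint _ hgm
      _ ≤ ∫⁻ ω, s.indicator g₀ ω ∂μ := by
          refine lintegral_mono fun ω => ?_
          by_cases hω : ω ∈ s
          · simp only [Set.indicator_of_mem hω]
            calc κ ω * (g₀ ω * (κ ω)⁻¹) = g₀ ω * (κ ω * (κ ω)⁻¹) := by ring
              -- Only an inequality holds, because `κ` may vanish and then `κ * κ⁻¹ = 0`.
              _ ≤ g₀ ω * 1 := by gcongr; exact ENNReal.mul_inv_le_one _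
              _ = g₀ ω := mul_one _
          · simp [Set.indicator_of_notMem hω]
      _ = ∫⁻ ω in s, g₀ ω ∂μ := lintegral_indicator (hm _ hset) _

end ChannelLaw

/-! ### Entropies of finite-valued variables as expectations. -/

section FiniteValued

/-- A countably-valued random variable almost surely takes values of positive probability. -/
theorem ae_measure_preimage_singleton_ne_zero {Ω S : Type*} [MeasurableSpace Ω]
    {μ : Measure Ω} [Countable S] (V : Ω → S) :
    ∀ᵐ ω ∂μ, μ (V ⁻¹' {V ω}) ≠ 0 := by
  have : ∀ᵐ ω ∂μ, ∀ s : S, μ (V ⁻¹' {s}) = 0 → V ω ≠ s := by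
    refine ae_all_iff.2 fun s => ?_
    by_cases h : μ (V ⁻¹' {s}) = 0
    · filter_upwards [measure_eq_zero_iff_ae_notMem.1 h] with ω hω _ using hω
    · exact ae_of_all _ fun ω h' => absurd h' h
  filter_upwards [this] with ω hω h using hω _ h rfl

variable {Ω S α β : Type*} [MeasurableSpace Ω] [MeasurableSpace S] [MeasurableSpace α]
  [MeasurableSpace β] {μ : Measure Ω} [IsProbabilityMeasure μ]

theorem integrable_comp_of_finite [Finite S] [DiscreteMeasurableSpace S] {V : Ω → S}
    (hV : Measurable V) (F : S → ℝ) : Integrable (fun ω => F (V ω)) μ := by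
  have : IsProbabilityMeasure (μ.map V) := Measure.isProbabilityMeasure_map hV.aemeasurable
  exact (Integrable.of_finite (μ := μ.map V) (f := F)).comp_measurable hV

theorem integral_comp_eq_sum [Fintype S] [DiscreteMeasurableSpace S] {V : Ω → S}
    (hV : Measurable V) (F : S → ℝ) :
    ∫ ω, F (V ω) ∂μ = ∑ s, (μ (V ⁻¹' {s})).toReal * F s := by
  have : IsProbabilityMeasure (μ.map V) := Measure.isProbabilityMeasure_map hV.aemeasurable
  rw [← integral_map (f := F) hV.aemeasurable (Measurable.of_discrete).aestronglyMeasurable,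
    integral_fintype Integrable.of_finite]
  refine Finset.sum_congr rfl fun s _ => ?_
  rw [map_measureReal_apply hV (measurableSet_singleton s), smul_eq_mul, measureReal_def]

theorem PMF_map_apply_eq [Countable S] [DiscreteMeasurableSpace S] [DiscreteMeasurableSpace α]
    {μ : Measure Ω} {V : Ω → S} (hV : Measurable V) {p : PMF S}
    (hp : ∀ s, p s = μ (V ⁻¹' {s})) (X : S → α) (a : α) : p.map X a = μ ((fun ω => X (V ω)) ⁻¹' {a}) := by
  have hX : Measurable X := Measurable.of_discrete
  have hpm : p.toMeasure = μ.map V := by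
    refine Measure.ext_of_singleton fun s => ?_
    rw [PMF.toMeasure_apply_singleton _ _ (measurableSet_singleton s),
      Measure.map_apply hV (measurableSet_singleton s), hp]
  rw [← PMF.toMeasure_apply_singleton _ _ (measurableSet_singleton a), ← PMF.toMeasure_map (p := p) (hf := hX),
    hpm, Measure.map_map hX hV, Measure.map_apply (hX.comp hV) (measurableSet_singleton a)]
  rfl

/-- Conditional entropy as the expectation of the conditional information. -/
theorem condEntropy_eq_integral [Countable S] [DiscreteMeasurableSpace S] [Fintype α]
    [DiscreteMeasurableSpace α] [Fintype β] [DiscreteMeasurableSpace β]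
    {V : Ω → S} (hV : Measurable V) {p : PMF S} (hp : ∀ s, p s = μ (V ⁻¹' {s}))
    (X : S → α) (Y : S → β) :
    condEntropy p X Y = -∫ ω, Real.logb 2
      ((μ ((fun ω => (X (V ω), Y (V ω))) ⁻¹' {(X (V ω), Y (V ω))})).toReal /
        (μ ((fun ω => Y (V ω)) ⁻¹' {Y (V ω)})).toReal) ∂μ := by
  have hXY : Measurable fun ω => (X (V ω), Y (V ω)) :=
    (Measurable.of_discrete (f := fun s => (X s, Y s))).comp hV
  rw [condEntropy, integral_comp_eq_sum hXY (fun z => Real.logb 2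
      ((μ ((fun ω => (X (V ω), Y (V ω))) ⁻¹' {z})).toReal /
        (μ ((fun ω => Y (V ω)) ⁻¹' {z.2})).toReal)), Fintype.sum_prod_type]
  simp only [PMF_map_apply_eq hV hp]

/-- A crude uniform bound for conditional entropies. -/
theorem abs_condEntropy_le {S α β : Type*} [Fintype α] [Fintype β] (p : PMF S) (X : S → α)
    (Y : S → β) : |condEntropy p X Y| ≤ Fintype.card α * (Fintype.card β * (Real.log 2)⁻¹) := by
  have hlog2 : 0 < Real.log 2 := Real.log_pos one_lt_two
  -- From `log y ≤ y - 1` at `y = b / a`, one gets `a * |log (a / b)| ≤ b ≤ 1`.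
  have hterm : ∀ a b : ℝ, 0 ≤ a → 0 ≤ b → a ≤ b → b ≤ 1 →
      |a * Real.logb 2 (a / b)| ≤ (Real.log 2)⁻¹ := by
    intro a b ha hb hab hb1
    rcases ha.eq_or_lt with rfl | ha
    · simp [hlog2.le]
    have hb : 0 < b := ha.trans_le hab
    have hle : Real.log (a / b) ≤ 0 := Real.log_nonpos (by positivity) ((div_le_one hb).2 hab)
    have hge : -Real.log (a / b) ≤ b / a := by
      rw [← Real.log_inv, inv_div]
      exact (Real.log_le_sub_one_of_pos (by positivity)).trans (by linarith)
    rw [Real.logb, abs_mul, abs_div, abs_of_pos ha, abs_of_pos hlog2, abs_of_nonpos hle,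
      ← mul_div_assoc, div_eq_mul_inv]
    refine mul_le_of_le_one_left (by positivity) ?_
    calc a * -Real.log (a / b) ≤ a * (b / a) := by gcongr
      _ = b := by field_simp
      _ ≤ 1 := hb1
  rw [condEntropy, abs_neg]
  refine (Finset.abs_sum_le_sum_abs _ _).trans ?_
  have hin : ∀ x, |∑ y, (p.map (fun s => (X s, Y s)) (x, y)).toReal *
      Real.logb 2 ((p.map (fun s => (X s, Y s)) (x, y)).toReal / (p.map Y y).toReal)| ≤
      Fintype.card β * (Real.log 2)⁻¹ := by
    intro x
    refine (Finset.abs_sum_le_sum_abs _ _).trans ?_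
    refine (Finset.sum_le_card_nsmul _ _ ((Real.log 2)⁻¹) fun y _ => ?_).trans (by simp)
    refine hterm _ _ ENNReal.toReal_nonneg ENNReal.toReal_nonneg ?_ ?_
    · refine ENNReal.toReal_mono (PMF.apply_ne_top _ _) ?_
      rw [PMF.map_apply, PMF.map_apply]
      refine ENNReal.tsum_le_tsum fun s => ?_
      by_cases h : (x, y) = (X s, Y s)
      · rw [if_pos h, if_pos (Prod.ext_iff.1 h).2]
      · rw [if_neg h]; exact zero_le
    · exact ENNReal.toReal_le_of_le_ofReal zero_le_one 
        (by rw [ENNReal.ofReal_one]; exact PMF.coe_le_one _ _)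
  exact (Finset.sum_le_card_nsmul _ _ _ fun x _ => hin x).trans (by simp)

end FiniteValued

/-! ### Directed information of the closed loop. -/

section Directed

variable {A A' : Type*}

/-- Needed because a real supremum dominates its members only when the family is bounded; any bound
uniform in the policy suffices. -/
theorem bddAbove_directedInfo [Fintype A] [Fintype A'] (W : Channel A A') (T : ℕ) :
    BddAbove (Set.range fun Q : InputPolicy A A' => directedInfo W Q T / (T : ℝ)) := by
  have hterm : ∀ t, ∃ c, ∀ Q : InputPolicy A A', condMutualInfo (jointLaw W Q (t + 1))
      (fun h => h.2 (Fin.last t)) (fun h => h.1) (fun h => Fin.init h.2) ≤ c := fun t =>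
    ⟨_, fun Q => (sub_le_sub_left (neg_le_of_abs_le (abs_condEntropy_le _ _ _)) _).trans
      (sub_le_sub_right (le_of_abs_le (abs_condEntropy_le _ _ _)) _)⟩
  choose c hc using hterm
  have hsum : ∀ Q : InputPolicy A A', directedInfo W Q T ≤ ∑ t ∈ Finset.range T, c t :=
    fun Q => Finset.sum_le_sum fun t _ => hc t Q
  refine ⟨(∑ t ∈ Finset.range T, c t) / T, ?_⟩
  rintro _ ⟨Q, rfl⟩
  exact div_le_div_of_nonneg_right (hsum Q) (Nat.cast_nonneg _)

theorem jointLaw_succ_apply (W : Channel A A') (Q : InputPolicy A A') (T : ℕ)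
    (a : Fin T → A) (b : Fin T → A') (α : A) (β : A') :
    jointLaw W Q (T + 1) (Fin.snoc a α, Fin.snoc b β) =
      jointLaw W Q T (a, b) * (Q T a b α * W T (Fin.snoc a α) b β) := by
  classical
  -- `Fin.snoc` is injective in both arguments, so a single term of the triple sum survives.
  have hne : ∀ (h : (Fin T → A) × (Fin T → A')) α' β', ¬ (h = (a, b) ∧ α' = α ∧ β' = β) →
      (PMF.pure ((Fin.snoc h.1 α', Fin.snoc h.2 β') : (Fin (T + 1) → A) × (Fin (T + 1) → A')))
        (Fin.snoc a α, Fin.snoc b β) = 0 := by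
    intro h α' β' hn
    rw [PMF.pure_apply, if_neg]
    intro he
    rw [Prod.mk.injEq, Fin.snoc_inj, Fin.snoc_inj] at he
    obtain ⟨⟨h1, h2⟩, h3, h4⟩ := he
    exact hn ⟨Prod.ext h1.symm h3.symm, h2.symm, h4.symm⟩
  rw [jointLaw, PMF.bind_apply, tsum_eq_single (a, b)]
  · rw [PMF.bind_apply, tsum_eq_single α]
    · rw [PMF.bind_apply, tsum_eq_single β]
      · simp
      · intro β' hβ'
        rw [hne (a, b) _ _ (by tauto), mul_zero]
    · intro α' hα'
      simp only [PMF.bind_apply]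
      rw [ENNReal.tsum_eq_zero.2, mul_zero]
      intro β'
      rw [hne (a, b) _ _ (by tauto), mul_zero]
  · intro h hh
    simp only [PMF.bind_apply]
    rw [ENNReal.tsum_eq_zero.2, mul_zero]
    intro α'
    rw [ENNReal.tsum_eq_zero.2, mul_zero]
    intro β'
    rw [hne _ _ _ (by tauto), mul_zero]

variable {Ω : Type*}

/-- The first `T` channel outputs. -/
def outputs (q' : ℕ → Ω → A') (T : ℕ) (ω : Ω) : Fin T → A' := fun i => q' i ω

/-- The first `T` channel inputs and outputs. -/
def history (q : ℕ → Ω → A) (q' : ℕ → Ω → A') (T : ℕ) (ω : Ω) : (Fin T → A) × (Fin T → A') :=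
  (outputs q T ω, outputs q' T ω)

theorem outputs_succ (q' : ℕ → Ω → A') (T : ℕ) (ω : Ω) :
    outputs q' (T + 1) ω = Fin.snoc (outputs q' T ω) (q' T ω) := by
  ext i
  refine Fin.lastCases ?_ (fun j => ?_) i <;> simp [outputs]

theorem channelPast_eq (q : ℕ → Ω → A) (q' : ℕ → Ω → A') (T : ℕ) (ω : Ω) :
    channelPast q q' T ω = (Fin.snoc (outputs q T ω) (q T ω), outputs q' T ω) := by
  rw [← outputs_succ]; rfl

theorem outputLikelihood_succ (W : Channel A A') (q : ℕ → Ω → A) (b : ℕ → A') (T : ℕ) (ω : Ω) :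
    outputLikelihood W q b (T + 1) ω =
      outputLikelihood W q b T ω * W T (fun i => q i ω) (fun i => b i) (b T) :=
  Finset.prod_range_succ _ _

theorem outputLikelihood_ne_top (W : Channel A A') (q : ℕ → Ω → A) (b : ℕ → A') (T : ℕ) (ω : Ω) :
    outputLikelihood W q b T ω ≠ ⊤ := ENNReal.prod_ne_top fun _ _ => PMF.apply_ne_top _ _

/-- The likelihood of the outputs as a function of the channel data. -/
theorem exists_outputLikelihood_eq (W : Channel A A') (q : ℕ → Ω → A) (q' : ℕ → Ω → A') (T : ℕ) :
    ∃ F : (Fin T → A) × (Fin T → A') → ENNReal,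
      ∀ ω, outputLikelihood W q (fun i => q' i ω) T ω = F (history q q' T ω) := by
  refine ⟨fun h => ∏ t : Fin T, W t (fun i => h.1 ⟨i, by omega⟩) (fun i => h.2 ⟨i, by omega⟩)
    (h.2 t), fun ω => ?_⟩
  rw [outputLikelihood, ← Fin.prod_univ_eq_prod_range
    (fun t => W t (fun i => q i ω) (fun i => q' i ω) (q' t ω))]
  rfl

variable [MeasurableSpace Ω]

/-- The law of the channel data of a process is the joint law for its input policy. -/
theorem jointLaw_eq {W : Channel A A'} {q : ℕ → Ω → A} {q' : ℕ → Ω → A'} {Q : InputPolicy A A'}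
    {μ : Measure Ω} [IsProbabilityMeasure μ]
    (hQ : ∀ t a b α, μ (history q q' t ⁻¹' {(a, b)}) * Q t a b α =
        μ (history q q' t ⁻¹' {(a, b)} ∩ q t ⁻¹' {α}))
    (hW : ∀ t a b β, μ (channelPast q q' t ⁻¹' {(a, b)} ∩ q' t ⁻¹' {β}) =
      μ (channelPast q q' t ⁻¹' {(a, b)}) * W t a b β) (T : ℕ)
    (h : (Fin T → A) × (Fin T → A')) :
    jointLaw W Q T h = μ (history q q' T ⁻¹' {h}) := by
  induction T with
  | zero =>
    have h1 : h = (Fin.elim0, Fin.elim0) := Subsingleton.elim _ _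
    have h2 : history q q' 0 ⁻¹' {h} = Set.univ :=
      Set.eq_univ_of_forall fun ω => Subsingleton.elim _ _
    rw [h2, measure_univ, jointLaw, h1]
    simp
  | succ T ih =>
    obtain ⟨a, b⟩ := h
    obtain ⟨a, α, rfl⟩ : ∃ a' α, a = Fin.snoc a' α := ⟨_, _, (Fin.snoc_init_self a).symm⟩
    obtain ⟨b, β, rfl⟩ : ∃ b' β, b = Fin.snoc b' β := ⟨_, _, (Fin.snoc_init_self b).symm⟩
    have h1 : history q q' T ⁻¹' {(a, b)} ∩ q T ⁻¹' {α} =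
        channelPast q q' T ⁻¹' {(Fin.snoc a α, b)} := by
      ext ω
      simp only [Set.mem_inter_iff, Set.mem_preimage, Set.mem_singleton_iff, channelPast_eq,
        history, Prod.mk.injEq, Fin.snoc_inj]
      tauto
    have h2 : history q q' (T + 1) ⁻¹' {(Fin.snoc a α, Fin.snoc b β)} =
        channelPast q q' T ⁻¹' {(Fin.snoc a α, b)} ∩ q' T ⁻¹' {β} := by
      ext ω
      simp only [Set.mem_inter_iff, Set.mem_preimage, Set.mem_singleton_iff, channelPast_eq,
        history, Prod.mk.injEq, Fin.snoc_inj, outputs_succ]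
      tauto
    rw [jointLaw_succ_apply, ih, ← mul_assoc, hQ, h1, h2, hW]

/-- The realised pair of past and output almost surely has positive probability, and that
probability has the channel factor as a divisor. -/
theorem ae_channel_ne_zero [Finite A] [Finite A'] {μ : Measure Ω} {W : Channel A A'} {q : ℕ → Ω → A}
    {q' : ℕ → Ω → A'}
    (hW : ∀ t a b β, μ (channelPast q q' t ⁻¹' {(a, b)} ∩ q' t ⁻¹' {β}) =
      μ (channelPast q q' t ⁻¹' {(a, b)}) * W t a b β) (t : ℕ) :
    ∀ᵐ ω ∂μ, W t (fun i => q i ω) (fun i => q' i ω) (q' t ω) ≠ 0 := by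
  filter_upwards [ae_measure_preimage_singleton_ne_zero (μ := μ)
    fun ω => (channelPast q q' t ω, q' t ω)] with ω hω h
  apply hω
  have : (fun ω => (channelPast q q' t ω, q' t ω)) ⁻¹' {(channelPast q q' t ω, q' t ω)} =
      channelPast q q' t ⁻¹' {channelPast q q' t ω} ∩ q' t ⁻¹' {q' t ω} := by
    ext; simp
  rw [this]
  exact (hW _ _ _ _).trans (by rw [h, mul_zero])

theorem ae_outputLikelihood_ne_zero [Finite A] [Finite A'] {μ : Measure Ω} {W : Channel A A'} {q : ℕ → Ω → A}
    {q' : ℕ → Ω → A'}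
    (hW : ∀ t a b β, μ (channelPast q q' t ⁻¹' {(a, b)} ∩ q' t ⁻¹' {β}) =
      μ (channelPast q q' t ⁻¹' {(a, b)}) * W t a b β) (T : ℕ) :
    ∀ᵐ ω ∂μ, outputLikelihood W q (fun i => q' i ω) T ω ≠ 0 := by
  filter_upwards [ae_all_iff.2 (ae_channel_ne_zero hW)] with ω hω
  exact Finset.prod_ne_zero_iff.2 fun t _ => hω t

variable [MeasurableSpace A] [MeasurableSpace A']

theorem measurable_outputs {q' : ℕ → Ω → A'} (hq' : ∀ t, Measurable (q' t)) (T : ℕ) :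
    Measurable (outputs q' T) := measurable_pi_lambda _ fun i => hq' i

theorem measurable_history {q : ℕ → Ω → A} {q' : ℕ → Ω → A'} (hq : ∀ t, Measurable (q t))
    (hq' : ∀ t, Measurable (q' t)) (T : ℕ) : Measurable (history q q' T) :=
  (measurable_outputs hq T).prodMk (measurable_outputs hq' T)

variable [Fintype A] [DiscreteMeasurableSpace A] [Fintype A'] [DiscreteMeasurableSpace A']
  {μ : Measure Ω} [IsProbabilityMeasure μ]

/-- The input policy given by the conditional laws of the inputs of a process. -/
theorem exists_inputPolicy {q : ℕ → Ω → A} {q' : ℕ → Ω → A'} (hq : ∀ t, Measurable (q t))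
    (hq' : ∀ t, Measurable (q' t)) :
    ∃ Q : InputPolicy A A', ∀ t a b α,
      μ (history q q' t ⁻¹' {(a, b)}) * Q t a b α =
        μ (history q q' t ⁻¹' {(a, b)} ∩ q t ⁻¹' {α}) := by
  have : ∀ t a b, ∃ P : PMF A, ∀ α, μ (history q q' t ⁻¹' {(a, b)}) * P α =
      μ (history q q' t ⁻¹' {(a, b)} ∩ q t ⁻¹' {α}) := by
    intro t a b
    set s := history q q' t ⁻¹' {(a, b)}
    have hs : MeasurableSet s := measurable_history hq hq' t (measurableSet_singleton _)
    by_cases h : μ s = 0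
    · have : Nonempty Ω := nonempty_of_isProbabilityMeasure μ
      -- On a null history any law will do; the point mass merely exhibits one.
      exact ⟨PMF.pure (q 0 (Classical.arbitrary Ω)), fun α => by
        rw [h, zero_mul, measure_mono_null Set.inter_subset_left h]⟩
    · have : IsProbabilityMeasure μ[|s] := cond_isProbabilityMeasure h
      have : IsProbabilityMeasure (μ[|s].map (q t)) :=
        Measure.isProbabilityMeasure_map (hq t).aemeasurable
      refine ⟨(μ[|s].map (q t)).toPMF, fun α => ?_⟩
      rw [Measure.toPMF_apply, Measure.map_apply (hq t) (measurableSet_singleton α),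
        cond_apply hs, ← mul_assoc, ENNReal.mul_inv_cancel h (measure_ne_top _ _), one_mul]
  choose Q hQ using this
  exact ⟨Q, hQ⟩

/-- The information density between the inputs and the outputs up to time `T`. -/
noncomputable def infoDensity (μ : Measure Ω) (W : Channel A A') (q : ℕ → Ω → A)
    (q' : ℕ → Ω → A') (T : ℕ) (ω : Ω) : ℝ :=
  Real.logb 2 (outputLikelihood W q (fun i => q' i ω) T ω).toReal -
    Real.logb 2 (μ (outputs q' T ⁻¹' {outputs q' T ω})).toReal

theorem integrable_infoDensity {W : Channel A A'} {q : ℕ → Ω → A} {q' : ℕ → Ω → A'}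
    (hq : ∀ t, Measurable (q t)) (hq' : ∀ t, Measurable (q' t)) (T : ℕ) :
    Integrable (infoDensity μ W q q' T) μ := by
  obtain ⟨F, hF⟩ := exists_outputLikelihood_eq W q q' T
  have := integrable_comp_of_finite (μ := μ) (measurable_history hq hq' T) (fun h =>
    Real.logb 2 (F h).toReal - Real.logb 2 (μ (outputs q' T ⁻¹' {h.2})).toReal)
  refine this.congr (ae_of_all _ fun ω => ?_)
  simp only [infoDensity, hF]
  rfl

/-- Directed information is the expectation of the information density. -/
theorem directedInfo_eq_integral {W : Channel A A'} {q : ℕ → Ω → A} {q' : ℕ → Ω → A'}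
    (hq : ∀ t, Measurable (q t)) (hq' : ∀ t, Measurable (q' t)) {Q : InputPolicy A A'}
    (hQ : ∀ t a b α, μ (history q q' t ⁻¹' {(a, b)}) * Q t a b α =
        μ (history q q' t ⁻¹' {(a, b)} ∩ q t ⁻¹' {α}))
    (hW : ∀ t a b β, μ (channelPast q q' t ⁻¹' {(a, b)} ∩ q' t ⁻¹' {β}) =
      μ (channelPast q q' t ⁻¹' {(a, b)}) * W t a b β) (T : ℕ) :
    directedInfo W Q T = ∫ ω, infoDensity μ W q q' T ω ∂μ := by
  induction T with
  | zero =>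
    have h2 : ∀ ω, outputs q' 0 ⁻¹' {outputs q' 0 ω} = Set.univ := fun ω =>
      Set.eq_univ_of_forall fun ω => Subsingleton.elim _ _
    simp [directedInfo, infoDensity, outputLikelihood, h2]
  | succ T ih =>
    have hV := measurable_history hq hq' (T + 1)
    have hp := jointLaw_eq hQ hW (T + 1)
    rw [directedInfo, Finset.sum_range_succ, ← directedInfo, ih, ← eq_sub_iff_add_eq',
      ← integral_sub (integrable_infoDensity hq hq' _) (integrable_infoDensity hq hq' _),
      condMutualInfo, condEntropy_eq_integral hV hp, condEntropy_eq_integral hV hp,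
      neg_sub_neg, ← integral_sub]
    · refine integral_congr_ae ?_
      -- Term `T` of the directed information is the expected increment of the information density:
      -- the ratio given the inputs is the channel factor, and the ratio given past outputs alone is
      -- `P(outputs up to T + 1) / P(outputs up to T)`. Positivity of all these quantities lets the
      -- logarithms split.
      filter_upwards [ae_channel_ne_zero hW T, ae_outputLikelihood_ne_zero hW T,
        ae_measure_preimage_singleton_ne_zero (μ := μ) (outputs q' T),
        ae_measure_preimage_singleton_ne_zero (μ := μ) (outputs q' (T + 1)),
        ae_measure_preimage_singleton_ne_zero (μ := μ) (channelPast q q' T)] with ω h1 h2 h3 h4 h5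
      have e1 : (fun ω => Fin.init (history q q' (T + 1) ω).2) = outputs q' T := rfl
      have e2 : (fun ω => ((history q q' (T + 1) ω).1, Fin.init (history q q' (T + 1) ω).2)) =
        channelPast q q' T := rfl
      have e3 : (fun ω => ((history q q' (T + 1) ω).2 (Fin.last T),
          Fin.init (history q q' (T + 1) ω).2)) ⁻¹' {((history q q' (T + 1) ω).2 (Fin.last T),
          Fin.init (history q q' (T + 1) ω).2)} =
          outputs q' (T + 1) ⁻¹' {outputs q' (T + 1) ω} := by
        ext ω'
        simp only [Set.mem_preimage, Set.mem_singleton_iff, Prod.mk.injEq, outputs_succ,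
          Fin.snoc_inj]
        exact and_comm
      have e4 : (fun ω => ((history q q' (T + 1) ω).2 (Fin.last T),
          (history q q' (T + 1) ω).1, Fin.init (history q q' (T + 1) ω).2)) ⁻¹'
          {((history q q' (T + 1) ω).2 (Fin.last T),
          (history q q' (T + 1) ω).1, Fin.init (history q q' (T + 1) ω).2)} =
          channelPast q q' T ⁻¹' {channelPast q q' T ω} ∩ q' T ⁻¹' {q' T ω} := by
        ext ω'
        simp only [Set.mem_preimage, Set.mem_singleton_iff, Prod.mk.injEq, Set.mem_inter_iff]
        exact ⟨fun h => ⟨Prod.ext h.2.1 h.2.2, h.1⟩,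
          fun h => ⟨h.2, (Prod.ext_iff.1 h.1).1, (Prod.ext_iff.1 h.1).2⟩⟩
      have e5 := hW T (channelPast q q' T ω).1 (channelPast q q' T ω).2 (q' T ω)
      have hpos : ∀ x : ENNReal, x ≠ 0 → x ≠ ⊤ → x.toReal ≠ 0 := fun x h h' =>
        (ENNReal.toReal_pos h h').ne'
      have p1 := hpos _ h1 (PMF.apply_ne_top _ _)
      have p2 := hpos _ h2 (outputLikelihood_ne_top _ _ _ _ _)
      have p3 := hpos _ h3 (measure_ne_top _ _)
      have p4 := hpos _ h4 (measure_ne_top _ _)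
      have p5 := hpos _ h5 (measure_ne_top _ _)
      simp only [e1, e2, e3, e4]
      have e5' : μ (channelPast q q' T ⁻¹' {channelPast q q' T ω} ∩ q' T ⁻¹' {q' T ω}) =
        μ (channelPast q q' T ⁻¹' {channelPast q q' T ω}) *
          W T (fun i => q i ω) (fun i => q' i ω) (q' T ω) := e5
      rw [infoDensity, infoDensity, outputLikelihood_succ, ENNReal.toReal_mul,
        Real.logb_mul p2 p1]
      have e7 : Fin.init (history q q' (T + 1) ω).2 = outputs q' T ω := rfl
      have e8 : ((history q q' (T + 1) ω).1, outputs q' T ω) = channelPast q q' T ω := rfl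
      simp only [e7, e8]
      rw [e5', ENNReal.toReal_mul, mul_div_cancel_left₀ _ p5, Real.logb_div p4 p3]
      ring
    · exact integrable_comp_of_finite hV fun h => Real.logb 2
        ((μ ((fun ω => ((history q q' (T + 1) ω).2 (Fin.last T), (history q q' (T + 1) ω).1,
          Fin.init (history q q' (T + 1) ω).2)) ⁻¹' {(h.2 (Fin.last T), h.1,
            Fin.init h.2)})).toReal /
        (μ ((fun ω => ((history q q' (T + 1) ω).1, Fin.init (history q q' (T + 1) ω).2)) ⁻¹'
          {(h.1, Fin.init h.2)})).toReal)
    · exact integrable_comp_of_finite hV fun h => Real.logb 2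
        ((μ ((fun ω => ((history q q' (T + 1) ω).2 (Fin.last T),
          Fin.init (history q q' (T + 1) ω).2)) ⁻¹' {(h.2 (Fin.last T), Fin.init h.2)})).toReal /
        (μ ((fun ω => Fin.init (history q q' (T + 1) ω).2) ⁻¹' {Fin.init h.2})).toReal)

end Directed

/-! ### The change-of-measure inequality and the lower bound on directed information. -/

section Converse

variable {Ω : Type*} [MeasurableSpace Ω] {A A' : Type*} [Fintype A] [MeasurableSpace A]
  [DiscreteMeasurableSpace A] [Fintype A'] [MeasurableSpace A'] [DiscreteMeasurableSpace A']

/-- Change of measure: if an event has probability at most `exp (-c)` for every fixed output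
sequence, then its probability in closed loop is controlled by the information between the inputs
and the outputs of the channel. -/
theorem mul_measure_sub_one_le_integral_infoDensity {E : Type*} [MeasurableSpace E]
    {μ : Measure Ω} [IsProbabilityMeasure μ] {W : Channel A A'} {x₀ : Ω → E} {w : ℕ → Ω → E}
    {q : ℕ → Ω → A} {q' : ℕ → Ω → A'} (hx₀ : Measurable x₀) (hw : ∀ t, Measurable (w t))
    (hq : ∀ t, Measurable (q t)) (hq' : ∀ t, Measurable (q' t))
    (hmarkov : ChannelMarkov μ x₀ w q q') (hgen : GeneratedByChannel μ W q q')
    (hW : ∀ t a b β, μ (channelPast q q' t ⁻¹' {(a, b)} ∩ q' t ⁻¹' {β}) =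
      μ (channelPast q q' t ⁻¹' {(a, b)}) * W t a b β) (T : ℕ)
    {s : Set Ω} (hs : MeasurableSet s) {sb : (ℕ → A') → Set (E × (ℕ → E))}
    (hsb : ∀ b, MeasurableSet (sb b))
    (hss : ∀ b ω, (∀ i < T, q' i ω = b i) → (ω ∈ s ↔ (x₀ ω, fun t => w t ω) ∈ sb b)) {c : ℝ}
    (hc : ∀ b, μ {ω | (x₀ ω, fun t => w t ω) ∈ sb b} ≤ ENNReal.ofReal (Real.exp (-c))) :
    c * μ.real s - 1 ≤ Real.log 2 * ∫ ω, infoDensity μ W q q' T ω ∂μ := by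
  have : Nonempty Ω := nonempty_of_isProbabilityMeasure μ
  have : Nonempty A' := ⟨q' 0 (Classical.arbitrary Ω)⟩
  set K := ENNReal.ofReal (Real.exp c) with hK
  set r : (Fin T → A') → ENNReal := fun b => μ (outputs q' T ⁻¹' {b}) with hr
  obtain ⟨F, hF⟩ := exists_outputLikelihood_eq W q q' T
  have hout := measurable_outputs hq' T
  have hhist := measurable_history hq hq' T
  -- The second factor is `2 ^ (-i)` almost surely, `i` being the information density. The first
  -- dominates `exp (c * 1_s)` both on and off `s`, whatever the sign of `c`.
  set g : Ω → ENNReal := fun ω => (1 + s.indicator (fun _ => K) ω) * (r (outputs q' T ω) *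
    (outputLikelihood W q (fun i => q' i ω) T ω)⁻¹) with hg
  have hgm : Measurable g := by
    simp only [hg, hF]
    exact (measurable_const.add (measurable_const.indicator hs)).mul
      (((Measurable.of_discrete (f := r)).comp hout).mul
        ((Measurable.of_discrete (f := F)).comp hhist).inv)
  have hrsum : ∑ b, r b = 1 := by
    have := sum_measure_preimage_singleton (μ := μ) (f := outputs q' T) Finset.univ
      fun b _ => hout (measurableSet_singleton b)
    simpa [hr] using this
  have hfiber : ∀ b, ∫⁻ ω in outputs q' T ⁻¹' {b}, g ω ∂μ ≤ 2 * r b := by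
    intro b
    -- An infinite extension of `b`; its values from `T` on are irrelevant to the fibre and the
    -- likelihood.
    set e : ℕ → A' := fun n => if h : n < T then b ⟨n, h⟩ else Classical.arbitrary A' with he
    have hset : outputs q' T ⁻¹' {b} = {ω | ∀ i < T, q' i ω = e i} := by
      ext ω
      simp only [Set.mem_preimage, Set.mem_singleton_iff, Set.mem_ofPred_eq]
      constructor
      · rintro rfl i hi
        simp [he, hi, outputs]
      · intro h
        ext i
        simpa [he, outputs] using h i i.2
    set ψ : E × (ℕ → E) → ENNReal := fun z => 1 + (sb e).indicator (fun _ => K) z with hψ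
    have hψm : Measurable ψ := by
      have : Measurable ((sb e).indicator fun _ => K) := measurable_const.indicator (hsb e)
      exact measurable_const.add this
    have hlik : ∀ ω ∈ outputs q' T ⁻¹' {b},
        outputLikelihood W q (fun i => q' i ω) T ω = outputLikelihood W q e T ω := by
      intro ω hω
      rw [hset] at hω
      refine Finset.prod_congr rfl fun t ht => ?_
      have ht := Finset.mem_range.1 ht
      have : (fun i : Fin t => q' i ω) = fun i : Fin t => e i :=
        funext fun i => hω i (i.2.trans ht)
      simp only [this, hω t ht]
    calc ∫⁻ ω in outputs q' T ⁻¹' {b}, g ω ∂μ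
        = ∫⁻ ω in outputs q' T ⁻¹' {b},
            r b * (ψ (x₀ ω, fun t => w t ω) * (outputLikelihood W q e T ω)⁻¹) ∂μ := by
          refine setLIntegral_congr_fun (hout (measurableSet_singleton b)) fun ω hω => ?_
          have hind : s.indicator (fun _ => K) ω =
              (sb e).indicator (fun _ => K) (x₀ ω, fun t => w t ω) := by
            have := hss e ω (by rw [hset] at hω; exact hω)
            by_cases h : ω ∈ s
            · rw [Set.indicator_of_mem h, Set.indicator_of_mem (this.1 h)]
            · rw [Set.indicator_of_notMem h, Set.indicator_of_notMem (mt this.2 h)]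
          simp only [hg, hψ, hlik ω hω, hind, Set.mem_singleton_iff.1 hω]
          ring
      _ = r b * ∫⁻ ω in {ω | ∀ i < T, q' i ω = e i},
            ψ (x₀ ω, fun t => w t ω) * (outputLikelihood W q e T ω)⁻¹ ∂μ := by
          rw [lintegral_const_mul' _ _ (measure_ne_top _ _), ← hset]
      _ ≤ r b * ∫⁻ ω, ψ (x₀ ω, fun t => w t ω) ∂μ := by
          refine mul_le_mul' le_rfl ?_
          exact lintegral_div_outputLikelihood_le hx₀ hw hq hq' hmarkov hgen hψm e T
      -- The expectation of `ψ` is `1 + exp c * P(sb e)`, and the frozen probability is at most `exp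
      -- (-c)`.
      _ ≤ r b * 2 := by
          gcongr
          have hz : Measurable fun ω => (x₀ ω, fun t => w t ω) :=
            hx₀.prodMk (measurable_pi_lambda _ hw)
          have hcomp : (fun ω => (sb e).indicator (fun _ => K) (x₀ ω, fun t => w t ω)) =
              ((fun ω => (x₀ ω, fun t => w t ω)) ⁻¹' sb e).indicator fun _ => K := rfl
          simp only [hψ]
          rw [lintegral_add_left measurable_const, hcomp,
            lintegral_indicator_const (hz (hsb e)), lintegral_one, measure_univ,
            ← one_add_one_eq_two]
          gcongr
          calc K * μ ((fun ω => (x₀ ω, fun t => w t ω)) ⁻¹' sb e)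
              ≤ K * ENNReal.ofReal (Real.exp (-c)) := by gcongr; exact hc e
            _ = 1 := by
              rw [hK, ← ENNReal.ofReal_mul (Real.exp_pos _).le, ← Real.exp_add]
              simp
      _ = 2 * r b := mul_comm _ _
  have hgint : ∫⁻ ω, g ω ∂μ ≤ 2 := by
    have huniv : (⋃ b, outputs q' T ⁻¹' {b}) = Set.univ :=
      Set.eq_univ_of_forall fun ω => Set.mem_iUnion.2 ⟨_, rfl⟩
    have hdisj : Pairwise (Function.onFun Disjoint fun b => outputs q' T ⁻¹' {b}) :=
      fun b b' hb => Disjoint.preimage _ (Set.disjoint_singleton.2 hb)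
    rw [← setLIntegral_univ, ← huniv,
      lintegral_iUnion (fun b => hout (measurableSet_singleton b)) hdisj, tsum_fintype]
    calc ∑ b, ∫⁻ ω in outputs q' T ⁻¹' {b}, g ω ∂μ ≤ ∑ b, 2 * r b :=
          Finset.sum_le_sum fun b _ => hfiber b
      _ = 2 := by rw [← Finset.mul_sum, hrsum, mul_one]
  have hgtop : ∫⁻ ω, g ω ∂μ ≠ ⊤ := ne_top_of_le_ne_top ENNReal.ofNat_ne_top hgint
  have hgi : Integrable (fun ω => (g ω).toReal) μ :=
    integrable_toReal_of_lintegral_ne_top hgm.aemeasurable hgtop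
  have hgle : ∫ ω, (g ω).toReal ∂μ ≤ 2 := by
    rw [integral_toReal hgm.aemeasurable (ae_lt_top hgm hgtop)]
    exact ENNReal.toReal_le_of_le_ofReal zero_le_two (by simpa using hgint)
  have hsi : Integrable (s.indicator fun _ => c) μ := (integrable_const c).indicator hs
  have hii : Integrable (infoDensity μ W q q' T) μ := integrable_infoDensity hq hq' T
  -- This is `y + 1 ≤ exp y ≤ g` at `y = c * 1_s - log 2 * i`. As `g` has integral at most `2`,
  -- integrating leaves the constant `2 - 1 = 1`.
  have hpt : ∀ᵐ ω ∂μ, s.indicator (fun _ => c) ω -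
      Real.log 2 * infoDensity μ W q q' T ω ≤ (g ω).toReal - 1 := by
    filter_upwards [ae_outputLikelihood_ne_zero hW T,
      ae_measure_preimage_singleton_ne_zero (μ := μ) (outputs q' T)] with ω h1 h2
    have p1 := ENNReal.toReal_pos h1 (outputLikelihood_ne_top _ _ _ _ _)
    have p2 : 0 < (r (outputs q' T ω)).toReal := ENNReal.toReal_pos h2 (measure_ne_top _ _)
    set l := (outputLikelihood W q (fun i => q' i ω) T ω).toReal with hl
    have hlog2 : Real.log 2 ≠ 0 := (Real.log_pos one_lt_two).ne'
    have hi : Real.log 2 * infoDensity μ W q q' T ω =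
        Real.log l - Real.log (r (outputs q' T ω)).toReal := by
      rw [infoDensity, mul_sub, Real.logb, Real.logb, mul_div_cancel₀ _ hlog2,
        mul_div_cancel₀ _ hlog2]
    have hexp := Real.add_one_le_exp (s.indicator (fun _ => c) ω -
      Real.log 2 * infoDensity μ W q q' T ω)
    have hle : Real.exp (s.indicator (fun _ => c) ω -
        Real.log 2 * infoDensity μ W q q' T ω) ≤ (g ω).toReal := by
      have hind : Real.exp (s.indicator (fun _ => c) ω) ≤
          (1 + s.indicator (fun _ => K) ω).toReal := by
        by_cases h : ω ∈ s
        · simp only [Set.indicator_of_mem h]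
          rw [ENNReal.toReal_add ENNReal.one_ne_top ENNReal.ofReal_ne_top,
            ENNReal.toReal_ofReal (Real.exp_pos _).le]
          simp
        · simp [Set.indicator_of_notMem h]
      rw [hi, Real.exp_sub, Real.exp_sub, Real.exp_log p1, Real.exp_log p2]
      simp only [hg]
      rw [ENNReal.toReal_mul, ENNReal.toReal_mul, ENNReal.toReal_inv, ← hl, div_div_eq_mul_div,
        mul_div_assoc, ← div_eq_mul_inv]
      gcongr
    linarith
  have hmono := integral_mono_ae (hsi.sub (hii.const_mul (Real.log 2)))
    (hgi.sub (integrable_const 1)) hpt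
  simp only [Pi.sub_apply] at hmono
  rw [integral_sub hsi (hii.const_mul _), integral_sub hgi (integrable_const 1),
    integral_indicator_const _ hs, integral_const_mul] at hmono
  simp only [smul_eq_mul, integral_const, probReal_univ, mul_one] at hmono
  linarith [mul_comm c (μ.real s)]

/-- An AMS closed loop forces the directed information up to time `T` to grow at rate at least `L`,
up to an arbitrarily small loss, for infinitely many `T`. -/
theorem frequently_le_directedInfo {N m : ℕ} {μ : Measure Ω} [IsProbabilityMeasure μ]
    {f : EuclideanSpace ℝ (Fin N) → EuclideanSpace ℝ (Fin N)} {B : Matrix (Fin N) (Fin m) ℝ}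
    {W : Channel A A'} {x w : ℕ → Ω → EuclideanSpace ℝ (Fin N)}
    {u : ℕ → Ω → EuclideanSpace ℝ (Fin m)} {q : ℕ → Ω → A} {q' : ℕ → Ω → A'}
    (hf : Differentiable ℝ f) (hinj : Function.Injective f) {L : ℝ}
    (hL : ∀ z, (2 : ℝ) ^ L ≤ |(fderiv ℝ f z).det|)
    (hx₀ : Measurable (x 0)) (hw : ∀ t, Measurable (w t))
    (hind : IndepFun (x 0) (fun ω t => w t ω) μ) (hac : μ.map (x 0) ≪ volume)
    (hmarkov : ChannelMarkov μ (x 0) w q q')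
    {γe : (t : ℕ) → (Fin (t + 1) → EuclideanSpace ℝ (Fin N)) → (Fin t → A') → A}
    {γ : (t : ℕ) → (Fin (t + 1) → A') → EuclideanSpace ℝ (Fin m)}
    (hcl : IsClosedLoop μ f B W γe γ x w u q q')
    (hAMS : IsAMS (μ.map fun ω t => x t ω)) {ε : ℝ} (hε : 0 < ε) :
    ∃ κ : ℝ, ∃ᶠ T : ℕ in atTop, ∃ Q : InputPolicy A A',
      L - 2 * ε * |L| - κ * (1 / (T : ℝ)) ≤ directedInfo W Q T / T := by
  have hBc : Continuous (Matrix.toEuclideanLin B) :=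
    LinearMap.continuous_of_finiteDimensional _
  have hq'm := hcl.measurable_output
  have hum : ∀ t, Measurable (u t) := fun t => by
    rw [show u t = fun ω => γ t (fun i => q' i ω) from funext (hcl.controller t)]
    exact (hcl.measurable_controller t).comp (measurable_outputs hq'm (t + 1))
  have hxm : ∀ t, Measurable (x t) := by
    intro t
    induction t with
    | zero => exact hx₀
    | succ t ih =>
      rw [show x (t + 1) = fun ω => f (x t ω) + Matrix.toEuclideanLin B (u t ω) + w t ω from
        funext (hcl.dynamics t)]
      exact ((hf.continuous.measurable.comp ih).add (hBc.measurable.comp (hum t))).add (hw t)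
  have hqm : ∀ t, Measurable (q t) := fun t => by
    rw [show q t = fun ω => γe t (fun i => x i ω) (fun i => q' i ω) from funext (hcl.encoder t)]
    exact (hcl.measurable_encoder t).comp
      ((measurable_outputs hxm (t + 1)).prodMk (measurable_outputs hq'm t))
  have hW : ∀ t a b β, μ (channelPast q q' t ⁻¹' {(a, b)} ∩ q' t ⁻¹' {β}) =
      μ (channelPast q q' t ⁻¹' {(a, b)}) * W t a b β := by
    intro t a b β
    have hpast : Measurable (channelPast q q' t) :=
      measurable_channelPast (fun i _ => hqm i) fun i _ => hq'm i
    have hS : MeasurableSet[jointPast (x 0) w q q' t] (channelPast q q' t ⁻¹' {(a, b)}) :=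
      ⟨Prod.fst ⁻¹' {(a, b)}, measurable_fst (measurableSet_singleton _), rfl⟩
    rw [measure_inter_output_eq hx₀ hw hqm hq'm hmarkov hcl.channel t β hS,
      setLIntegral_congr_fun (g := fun _ => W t a b β) (hpast (measurableSet_singleton _))
        (fun ω hω => by
          have : channelPast q q' t ω = (a, b) := hω
          simp only [this]),
      setLIntegral_const, mul_comm]
  obtain ⟨Q, hQ⟩ := exists_inputPolicy (μ := μ) hqm hq'm
  have : IsProbabilityMeasure (μ.map (x 0)) := Measure.isProbabilityMeasure_map hx₀.aemeasurable
  obtain ⟨G, hG, hGε, M, hM⟩ := exists_bounded_density_set hac hε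
  rw [map_measureReal_apply hx₀ hG.compl] at hGε
  obtain ⟨r, hr⟩ := hAMS.exists_closedBall hxm hε
  set K : Set (EuclideanSpace ℝ (Fin N)) := Metric.closedBall 0 r with hKdef
  have hK : MeasurableSet K := Metric.isClosed_closedBall.measurableSet
  have hKtop : volume K ≠ ⊤ := measure_closedBall_lt_top.ne
  -- The summand `1` keeps `D` positive, so that `log D` can enter `c`.
  set D : ℝ := M * (volume K).toReal + 1 with hD
  have hD0 : 0 < D := by positivity
  have hδ : (0 : ℝ) < 2 ^ L := by positivity
  have hlog2 : 0 < Real.log 2 := Real.log_pos one_lt_two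
  refine ⟨(|Real.log D| + 1) / Real.log 2, ?_⟩
  refine (hr.and_eventually (eventually_ge_atTop 1)).mono fun T hT => ?_
  obtain ⟨hT, hT1⟩ := hT
  refine ⟨Q, ?_⟩
  -- Chosen so that `exp (-c) = D * 2 ^ (-L T)`, which dominates the frozen hitting probability.
  set c : ℝ := T * (L * Real.log 2) - Real.log D with hc
  set v : (ℕ → A') → (ℕ → EuclideanSpace ℝ (Fin N)) → ℕ → EuclideanSpace ℝ (Fin N) :=
    fun b η t => Matrix.toEuclideanLin B (γ t fun i => b i) + η t with hv
  have hvm : ∀ b t, Measurable fun η => v b η t := fun b t =>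
    measurable_const.add (measurable_pi_apply t)
  set s : Set Ω := {ω | x 0 ω ∈ G ∧ x T ω ∈ K} with hs
  have hsm : MeasurableSet s := (hx₀ hG).inter (hxm T hK)
  have hkey := mul_measure_sub_one_le_integral_infoDensity hx₀ hw hqm hq'm hmarkov hcl.channel hW T
    -- The event with outputs frozen to `b`: the controls up to `T - 1` use only `b_0, …, b_{T-1}`,
    -- so it agrees with `s` wherever the true outputs match `b` before `T`.
    hsm (sb := fun b => {z | z.1 ∈ G ∧ orbit f (v b z.2) T z.1 ∈ K}) (c := c)
    (fun b => (measurable_fst hG).inter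
      (measurable_orbit hf.continuous.measurable (fun t => (hvm b t).comp measurable_snd)
        measurable_fst T hK))
    (fun b ω hb => by
      have h1 : x T ω = orbit f (fun t => Matrix.toEuclideanLin B (u t ω) + w t ω) T (x 0 ω) :=
        eq_orbit (x := fun t => x t ω) (fun t => by rw [hcl.dynamics, add_assoc]) T
      have h2 := orbit_congr f (v := fun t => Matrix.toEuclideanLin B (u t ω) + w t ω)
        (v' := v b fun t => w t ω) (T := T) (fun t ht => by
          have : (fun i : Fin (t + 1) => q' i ω) = fun i : Fin (t + 1) => b i :=
            funext fun i => hb i (by omega)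
          simp only [hv, hcl.controller, this]) (x 0 ω)
      rw [← h1] at h2
      simp only [hs, Set.mem_ofPred_eq, h2])
    (fun b => by
      refine (measure_orbit_mem_le hf hinj hδ hL hx₀ (measurable_pi_lambda _ hw) hind (hvm b)
        hG hK hM T).trans ?_
      have hexp : Real.exp (-c) = D * ((2 : ℝ) ^ L)⁻¹ ^ T := by
        rw [hc, neg_sub, Real.exp_sub, Real.exp_log hD0, Real.exp_nat_mul, mul_comm L,
          ← Real.rpow_def_of_pos two_pos, inv_pow, div_eq_mul_inv]
      rw [hexp, mul_left_comm, mul_comm D, ENNReal.ofReal_mul (by positivity),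
        ENNReal.ofReal_pow (by positivity)]
      gcongr
      rw [← ENNReal.ofReal_toReal hKtop, ← ENNReal.ofReal_natCast,
        ← ENNReal.ofReal_mul (by positivity)]
      exact ENNReal.ofReal_le_ofReal (by rw [hD]; linarith))
  rw [← directedInfo_eq_integral hqm hq'm hQ hW] at hkey
  set p := μ.real s with hp
  have hp1 : p ≤ 1 := measureReal_le_one
  -- One `ε` is lost outside `G`, the other outside the ball.
  have hp2 : 1 - 2 * ε ≤ p := by
    have hsub : x T ⁻¹' K ⊆ s ∪ x 0 ⁻¹' Gᶜ := fun ω hω => by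
      by_cases h : x 0 ω ∈ G
      · exact Or.inl ⟨h, hω⟩
      · exact Or.inr h
    have := (measureReal_mono (μ := μ) hsub).trans (measureReal_union_le _ _)
    linarith
  have hp0 : 0 ≤ p := measureReal_nonneg
  have hT0 : (0 : ℝ) < T := by exact_mod_cast hT1
  -- The loss is measured by `|L|` because `L` may be negative.
  have hpL : L - 2 * ε * |L| ≤ p * L := by
    have h1 : (1 - p) * L ≤ (1 - p) * |L| :=
      mul_le_mul_of_nonneg_left (le_abs_self L) (by linarith)
    have h2 : (1 - p) * |L| ≤ 2 * ε * |L| :=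
      mul_le_mul_of_nonneg_right (by linarith) (abs_nonneg L)
    linarith
  have hpD : p * Real.log D ≤ |Real.log D| :=
    (mul_le_mul_of_nonneg_left (le_abs_self _) hp0).trans
      (mul_le_of_le_one_left (abs_nonneg _) hp1)
  rw [le_div_iff₀ hT0, ← mul_le_mul_iff_right₀ hlog2]
  calc Real.log 2 * ((L - 2 * ε * |L| - (|Real.log D| + 1) / Real.log 2 * (1 / (T : ℝ))) * T)
      = T * Real.log 2 * (L - 2 * ε * |L|) - |Real.log D| - 1 := by field_simp; ring
    _ ≤ T * Real.log 2 * (p * L) - p * Real.log D - 1 := by gcongr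
    _ = c * p - 1 := by rw [hc]; ring
    _ ≤ _ := hkey

end Converse

end NetworkedControl

theorem mainTheorem1 {Ω : Type*} [MeasurableSpace Ω] (μ : Measure Ω) [IsProbabilityMeasure μ]
    {A A' : Type*} [Fintype A] [MeasurableSpace A] [DiscreteMeasurableSpace A]
    [Fintype A'] [MeasurableSpace A'] [DiscreteMeasurableSpace A']
    {N m : ℕ}
    (f : EuclideanSpace ℝ (Fin N) → EuclideanSpace ℝ (Fin N)) (B : Matrix (Fin N) (Fin m) ℝ)
    (ν : Measure (EuclideanSpace ℝ (Fin N)))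
    (W : NetworkedControl.Channel A A') (C : ℝ)
    (x w : ℕ → Ω → EuclideanSpace ℝ (Fin N)) (u : ℕ → Ω → EuclideanSpace ℝ (Fin m))
    (q : ℕ → Ω → A) (q' : ℕ → Ω → A')
    -- the plant: `f` is continuously differentiable and invertible, with bounded log-Jacobian
    (hf : ContDiff ℝ 1 f) (hinv : Function.Bijective f)
    (hJ : NetworkedControl.BoundedLogJac f)
    -- the noise and the initial state, with `h(x₀) < ∞`
    (hw : NetworkedControl.IsNoise μ ν (x 0) w)
    (hx₀ : NetworkedControl.HasDiffEntropy (μ.map (x 0)))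
    (hx₀' : NetworkedControl.diffEntropy (μ.map (x 0)) < ⊤)
    -- Class A channel with feedback and capacity `C`
    (hA : NetworkedControl.IsClassA μ W C (x 0) w q q')
    -- some causal encoding and control policy makes the state process AMS
    (hpolicy : ∃ γe γ, NetworkedControl.IsClosedLoop μ f B W γe γ x w u q q')
    (hAMS : NetworkedControl.IsAMS (μ.map (fun ω t => x t ω))) :
    ⨅ z, NetworkedControl.logJac f z ≤ C := by
  obtain ⟨γe, γ, hcl⟩ := hpolicy
  set L := ⨅ z, NetworkedControl.logJac f z with hLdef
  have hL : ∀ z, (2 : ℝ) ^ L ≤ |(fderiv ℝ f z).det| := fun z =>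
    (Real.le_logb_iff_rpow_le one_lt_two (abs_pos.2 (hJ.det_ne_zero z))).1
      (ciInf_le hJ.bddBelow z)
  refine le_of_forall_pos_le_add fun η hη => ?_
  -- This choice makes the loss `2 * ε * |L|` at most `η`; the `+ 1` covers `L = 0`.
  have hε : 0 < η / (2 * (|L| + 1)) := by positivity
  obtain ⟨κ, hκ⟩ := NetworkedControl.frequently_le_directedInfo
    (hf.differentiable one_ne_zero) hinv.injective hL hw.measurable_init hw.measurable_noise
    hw.indep_init hx₀.1 hA.markov hcl hAMS hε
  have hεL : 2 * (η / (2 * (|L| + 1))) * |L| ≤ η := by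
    have : 2 * (η / (2 * (|L| + 1))) * |L| = η * (|L| / (|L| + 1)) := by field_simp
    rw [this]
    exact mul_le_of_le_one_right hη.le ((div_le_one (by positivity)).2 (by linarith))
  -- The error `κ / T` is absorbed into the capacity limit. The lower bound for infinitely many `T`
  -- is enough because that limit exists: one large `T` from the sequence gives the contradiction.
  have hlim := hA.capacity.add (tendsto_one_div_atTop_nhds_zero_nat.const_mul κ)
  rw [mul_zero, add_zero] at hlim
  by_contra! hlt
  obtain ⟨T, ⟨Q, hQ⟩, hT⟩ :=
    (hκ.and_eventually (hlim.eventually (gt_mem_nhds (by linarith : C < L - η)))).exists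
  have := le_ciSup (NetworkedControl.bddAbove_directedInfo W T) Q
  linarith
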